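/- For complex $a,q$ with $|q|<1$ let $(a;q)_\infty=\prod_{n\ge 0}(1-aq^n)$, and define integers $p_{-1}(n)$ by $(q;q)_\infty=\sum_{n=0}^\infty p_{-1}(n)q^n$ for $|q|<1$. Let $$R(q)=\cfrac{q^{1/5}}{1+\cfrac{q}{1+\cfrac{q^2}{1+\cfrac{q^3}{1+\cdots}}}}$$ be the Rogers–Ramanujan continued fraction, where for $0<|q|<1$ any fifth root $q^{1/5}$ of $q$ may be chosen, the same one throughout; the continued fraction converges to a nonzero value for every such $q$. (a) Let $k\ge 1$ be odd. Then, for $|q|<1$ (for $0<|q|<1$ in the two identities that contain $R(q)$), $$\sum_{n=0}^{\infty} p_{-1}\Bigl(5^{k}n+\tfrac{5^{k+1}-1}{24}\Bigr)q^{n}=i^{k+1}(q^{5};q^{5})_{\infty},$$ $$\sum_{n=0}^{\infty} p_{-1}\Bigl(5^{k}n+\tfrac{5^{k+1}-1}{24}-5^{k-1}\Bigr)q^{n}=\frac{i^{k-1}q^{1/5}(q^{5};q^{5})_{\infty}}{R(q)},$$ $$\sum_{n=0}^{\infty} p_{-1}\Bigl(5^{k}n+\tfrac{5^{k+1}-1}{24}+5^{k-1}\Bigr)q^{n}=i^{k+1}q^{-1/5}(q^{5};q^{5})_{\infty}R(q),$$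 $$\sum_{n=0}^{\infty} p_{-1}\Bigl(5^{k}n+\tfrac{5^{k+1}-1}{24}+2\cdot 5^{k-1}\Bigr)q^{n}=\sum_{n=0}^{\infty} p_{-1}\Bigl(5^{k}n+\tfrac{5^{k+1}-1}{24}+3\cdot 5^{k-1}\Bigr)q^{n}=0.$$ (b) Let $k\ge 2$ be even and $m\in\{0,1,2,3,4\}$. Then, for $|q|<1$, $$\sum_{n=0}^{\infty} p_{-1}\Bigl(5^{k}n+\tfrac{5^{k}-1}{24}+5^{k-1}m\Bigr)q^{n}=\bigl(1-\chi_{1,5}(m)\bigr)\,i^{k}\,(q;q)_{\infty},$$ where $\chi_{1,5}$ is the principal Dirichlet character modulo $5$. (c) (Watson's modular equation.) For $|q|<1$, $$q\frac{(q^{5};q^{5})_{\infty}^{6}}{(q;q)_{\infty}^{6}}=5^{2}q^{5}\frac{(q^{25};q^{25})_{\infty}^{5}}{(q;q)_{\infty}^{5}}+5^{2}q^{4}\frac{(q^{25};q^{25})_{\infty}^{4}}{(q;q)_{\infty}^{4}}+15q^{3}\frac{(q^{25};q^{25})_{\infty}^{3}}{(q;q)_{\infty}^{3}}+5q^{2}\frac{(q^{25};q^{25})_{\infty}^{2}}{(q;q)_{\infty}^{2}}+q\frac{(q^{25};q^{25})_{\infty}}{(q;q)_{\infty}}.$$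 -/

import Mathlib

open Filter Topology

noncomputable section

/-- The infinite `q`-shifted factorial `(a; q)_∞ = ∏_{n ≥ 0} (1 - a q^n)`, for `|q| < 1`. -/
def qPochInf (a q : ℂ) : ℂ := ∏' n : ℕ, (1 - a * q ^ n)

open scoped PowerSeries.WithPiTopology in
/-- The coefficient `p_{-1}(n)` of `X ^ n` in the formal power series
`∏_{m ≥ 1} (1 - X ^ m)`, that is, in `(q; q)_∞`. -/
def pNegOne (n : ℕ) : ℤ :=
  PowerSeries.coeff n (∏' m : ℕ, (1 - (PowerSeries.X : PowerSeries ℤ) ^ (m + 1)))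

/-- The Rogers–Ramanujan continued fraction
`t / (1 + q / (1 + q ^ 2 / (1 + q ^ 3 / (1 + ⋯))))` with `q = t ^ 5`, as a formal continued
fraction: integer part `0`, partial numerators `t, q, q ^ 2, …`, and all partial denominators `1`.
The parameter `t` is the chosen fifth root `q ^ (1/5)`. -/
def rogersRamanujanFrac (t : ℂ) : GenContFract ℂ where
  h := 0
  s := Stream'.Seq.ofStream fun n : ℕ => ⟨if n = 0 then t else (t ^ 5) ^ n, 1⟩

/-- The value `R(q)`, `q = t ^ 5`, of the Rogers–Ramanujan continued fraction: the limit of its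
convergents. -/
def rogersRamanujan (t : ℂ) : ℂ := limUnder atTop (rogersRamanujanFrac t).convs

end

/-! By the pentagonal number theorem, p₋₁(N) is (-1)^k if N = k(3k-1)/2 and 0 if N is not of this
form. Since 24N+1 = (6k-1)², multiplying 24N+1 by 25 gives p₋₁(25n+1) = -p₋₁(n)
(`pNegOne_twentyFive_mul_add_one`). Iterating this reduces odd k to k = 1 (`pNegOne_odd_power`), and
even k to the class 1 mod 5, where only the indices 25n+1 contribute.

For k = 1 one needs the 5-dissection of E(q) = (q;q)_∞. The classes 3 and 4 contain no pentagonal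
number, and class 1 gives -E(q⁵). Classes 0 and 2 are each a sum of two theta series, which the
quintuple product identity (`quintuple_theta`) turns into E(q⁵) times a ratio of the theta series
∑(-1)ⁿq^((5n²+n)/2) and ∑(-1)ⁿq^((5n²+3n)/2). These are the values at k = 0, 1 of Rogers' functions
`rogersSum q k`. Their three-term recurrence (`rogersSum_recurrence`) is adjoint to that of the
continuants, so the continued fraction converges to t times the ratio of the two theta series
(`tendsto_continuant`).

For Watson's equation, write E = a - u + v with u = qE(q²⁵) and av = -u² (`qPochInf_dissection`).
Replacing q by wq with w⁵ = 1 and multiplying gives a⁵ + v⁵ - 11u⁵, while the same product is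
E(q⁵)⁶/E(q²⁵) (`prod_qPochInf_roots`). Since a + v = E + u, this is a polynomial identity in E and
u. -/

/-! ### Euler's product: bounds, convergence, nonvanishing. -/

lemma summable_norm_pow {q : ℂ} (hq : ‖q‖ < 1) : Summable fun n : ℕ => ‖q‖ ^ n :=
  summable_geometric_of_lt_one (norm_nonneg _) hq

/-- The finite products of factors `1 - q ^ j` are uniformly bounded for `‖q‖ < 1`. -/
lemma norm_prod_one_sub_pow_le {q : ℂ} (hq : ‖q‖ < 1) (a n : ℕ) :
    ‖∏ i ∈ Finset.range n, (1 - q ^ (a + i + 1))‖ ≤ Real.exp (1 - ‖q‖)⁻¹ := by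
  calc ‖∏ i ∈ Finset.range n, (1 - q ^ (a + i + 1))‖
      ≤ ∏ i ∈ Finset.range n, ‖1 - q ^ (a + i + 1)‖ := Finset.norm_prod_le _ _
    _ ≤ ∏ i ∈ Finset.range n, (1 + ‖q‖ ^ i) := by
        refine Finset.prod_le_prod (fun _ _ => norm_nonneg _) fun i _ => ?_
        refine (norm_sub_le _ _).trans ?_
        rw [norm_one, norm_pow]
        gcongr 1 + ?_
        exact pow_le_pow_of_le_one (norm_nonneg _) hq.le (by lia)
    _ ≤ Real.exp (∑ i ∈ Finset.range n, ‖q‖ ^ i) :=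
        Real.prod_one_add_le_exp_sum _ fun i => by positivity
    _ ≤ Real.exp (1 - ‖q‖)⁻¹ := by
        rw [← tsum_geometric_of_lt_one (norm_nonneg _) hq]
        exact Real.exp_le_exp.mpr ((summable_norm_pow hq).sum_le_tsum _ fun _ _ => by positivity)

lemma norm_neg_one_pow_mul (n : ℕ) (x : ℂ) : ‖(-1) ^ n * x‖ = ‖x‖ := by simp

lemma qPochInf_self (q : ℂ) : qPochInf q q = ∏' n : ℕ, (1 - q ^ (n + 1)) := by
  simp only [qPochInf, pow_succ']

lemma qPochInf_self_ne_zero {q : ℂ} (hq : ‖q‖ < 1) : qPochInf q q ≠ 0 := by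
  rw [qPochInf_self]
  simp only [sub_eq_add_neg]
  refine tprod_one_add_ne_zero_of_summable (fun n h => ?_) ?_
  · have h1 : q ^ (n + 1) = 1 := by linear_combination -h
    have h2 := congrArg norm h1
    rw [norm_pow, norm_one] at h2
    exact (pow_lt_one₀ (norm_nonneg _) hq (Nat.succ_ne_zero n)).ne h2
  · simpa only [norm_neg, norm_pow] using (summable_nat_add_iff 1).mpr (summable_norm_pow hq)

lemma multipliable_one_sub_pow_add {q : ℂ} (hq : ‖q‖ < 1) (k : ℕ) :
    Multipliable fun n : ℕ => 1 - q ^ (n + k + 1) := by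
  simp only [sub_eq_add_neg, add_assoc]
  apply multipliable_one_add_of_summable
  simpa only [norm_neg, norm_pow] using (summable_nat_add_iff (k + 1)).mpr (summable_norm_pow hq)

lemma hasProd_qPochInf_self {q : ℂ} (hq : ‖q‖ < 1) :
    HasProd (fun n : ℕ => 1 - q ^ (n + 1)) (qPochInf q q) := by
  rw [qPochInf_self]
  exact (multipliable_one_sub_pow_add hq 0).hasProd

/-! ### The coefficients of Euler's product -/

lemma pNegOne_eq_coeff (n : ℕ) : pNegOne n = (PowerSeries.pentagonalSeries ℤ).coeff n := by
  rw [pNegOne, PowerSeries.WithPiTopology.tprod_one_sub_X_pow]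

lemma pNegOne_pentagonal (k : ℤ) : pNegOne (pentagonal k) = k.negOnePow := by
  rw [pNegOne_eq_coeff, PowerSeries.coeff_pentagonalSeries_pentagonal, Int.cast_id]

lemma pNegOne_eq_zero {n : ℕ} (h : ∀ k : ℤ, (k * (3 * k - 1) : ℤ) ≠ 2 * n) : pNegOne n = 0 := by
  rw [pNegOne_eq_coeff, PowerSeries.coeff_pentagonalSeries_eq_zero]
  rintro ⟨k, rfl⟩
  exact h k (two_mul_natCast_pentagonal k).symm

lemma pNegOne_of_eq {n : ℕ} {k : ℤ} (h : (k * (3 * k - 1) : ℤ) = 2 * n) :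
    pNegOne n = k.negOnePow := by
  rw [← pNegOne_pentagonal]
  congr 1
  have := two_mul_natCast_pentagonal k
  lia

lemma negOnePow_cast_eq_zpow (k : ℤ) : ((k.negOnePow : ℤ) : ℂ) = (-1) ^ k := by
  rcases Int.even_or_odd k with h | h
  · rw [Int.negOnePow_even _ h, h.neg_one_zpow]; simp
  · rw [Int.negOnePow_odd _ h, h.neg_one_zpow]; simp

lemma norm_pNegOne_le (n : ℕ) : ‖(pNegOne n : ℂ)‖ ≤ 1 := by
  by_cases h : ∃ k : ℤ, (k * (3 * k - 1) : ℤ) = 2 * n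
  · obtain ⟨k, hk⟩ := h
    rw [pNegOne_of_eq hk, negOnePow_cast_eq_zpow, norm_zpow]
    simp
  · rw [pNegOne_eq_zero (by simpa using h)]
    simp

lemma summable_pNegOne {q : ℂ} (hq : ‖q‖ < 1) (f : ℕ → ℕ) :
    Summable fun n : ℕ => (pNegOne (f n) : ℂ) * q ^ n := by
  refine .of_norm_bounded (summable_norm_pow hq) fun n => ?_
  rw [norm_mul, norm_pow]
  exact mul_le_of_le_one_left (by positivity) (norm_pNegOne_le _)

lemma hasSum_pentagonal_iff {q a : ℂ} :
    HasSum (fun k : ℤ => (-1) ^ k * q ^ pentagonal k) a ↔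
      HasSum (fun n : ℕ => (pNegOne n : ℂ) * q ^ n) a := by
  rw [← pentagonal_injective.hasSum_iff (f := fun n : ℕ => (pNegOne n : ℂ) * q ^ n)]
  · simp only [Function.comp_def, pNegOne_pentagonal, negOnePow_cast_eq_zpow]
  · intro n hn
    rw [pNegOne_eq_zero, Int.cast_zero, zero_mul]
    intro k hk
    refine hn ⟨k, ?_⟩
    have := two_mul_natCast_pentagonal k
    lia

/-- **Pentagonal number theorem** for complex numbers. -/
theorem hasSum_pentagonal {q : ℂ} (hq : ‖q‖ < 1) :
    HasSum (fun k : ℤ => (-1) ^ k * q ^ pentagonal k) (qPochInf q q) := by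
  have hs : Summable fun k : ℤ => (-1) ^ k * q ^ pentagonal k :=
    ⟨_, hasSum_pentagonal_iff.mpr (summable_pNegOne hq id).hasSum⟩
  -- Pairing the indices -k and k+1 folds the bilateral series into the one-sided form of
  -- `Pentagonal.tprod_one_sub_pow`.
  have hs' : HasSum (fun k : ℕ => (-1) ^ k * (q ^ pentagonal (-k) - q ^ pentagonal (k + 1)))
      (∑' k : ℤ, (-1) ^ k * q ^ pentagonal k) := by
    have h := ((Equiv.neg ℤ).hasSum_iff.mpr hs.hasSum).nat_add_neg_add_one
    refine h.congr_fun fun k => ?_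
    simp only [Function.comp_apply, Equiv.neg_apply, neg_neg]
    rw [zpow_neg, zpow_add₀ (by simp), zpow_natCast, zpow_one, ← inv_pow]
    norm_num
    ring
  have hb : ∀ k n : ℕ, ‖q ^ ((k + 1) * n) * ∏ i ∈ Finset.range (n + 1), (1 - q ^ (k + i + 1))‖
      ≤ ‖q‖ ^ n * Real.exp (1 - ‖q‖)⁻¹ := by
    intro k n
    rw [norm_mul, norm_pow]
    exact mul_le_mul (pow_le_pow_of_le_one (norm_nonneg _) hq.le
      (Nat.le_mul_of_pos_left n k.succ_pos)) (norm_prod_one_sub_pow_le hq _ _)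
      (norm_nonneg _) (by positivity)
  have hbs := (summable_norm_pow hq).mul_right (Real.exp (1 - ‖q‖)⁻¹)
  have key := Pentagonal.tprod_one_sub_pow (x := q)
    (tendsto_pow_atTop_nhds_zero_of_norm_lt_one hq)
    (fun k => .of_norm_bounded hbs (hb k)) (multipliable_one_sub_pow_add hq) hs'.summable ?_
  · rw [qPochInf_self, key, hs'.tsum_eq]
    exact hs.hasSum
  -- The remainder after k steps of Euler's recursion is a uniformly bounded sum times a power of q
  -- with exponent at least k.
  · refine squeeze_zero_norm (a := fun k => ‖q‖ ^ k * ∑' n, ‖q‖ ^ n * Real.exp (1 - ‖q‖)⁻¹)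
      (fun k => ?_) ?_
    · rw [norm_mul, norm_neg_one_pow_mul, norm_pow]
      exact mul_le_mul (pow_le_pow_of_le_one (norm_nonneg _) hq.le
        ((Nat.le_div_iff_mul_le two_pos).mpr (by nlinarith)))
        (tsum_of_norm_bounded hbs.hasSum (hb k)) (norm_nonneg _) (by positivity)
    · rw [← zero_mul (∑' n, ‖q‖ ^ n * Real.exp (1 - ‖q‖)⁻¹)]
      exact (tendsto_pow_atTop_nhds_zero_of_lt_one (norm_nonneg _) hq).mul_const _

theorem hasSum_pNegOne {q : ℂ} (hq : ‖q‖ < 1) :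
    HasSum (fun n : ℕ => (pNegOne n : ℂ) * q ^ n) (qPochInf q q) :=
  hasSum_pentagonal_iff.mp (hasSum_pentagonal hq)

/-! ### Congruence properties of the coefficients -/

lemma int_exists_five_mul_add (k : ℤ) : ∃ j : ℤ, k = 5 * j ∨ k = 5 * j + 1 ∨ k = 5 * j + 2 ∨
    k = 5 * j + 3 ∨ k = 5 * j + 4 :=
  ⟨k / 5, by lia⟩

lemma pNegOne_five_mul_add_three (n : ℕ) : pNegOne (5 * n + 3) = 0 := by
  refine pNegOne_eq_zero fun k hk => ?_
  obtain ⟨j, rfl | rfl | rfl | rfl | rfl⟩ := int_exists_five_mul_add k <;> push_cast at hk <;>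
    ring_nf at hk <;> lia

lemma pNegOne_five_mul_add_four (n : ℕ) : pNegOne (5 * n + 4) = 0 := by
  refine pNegOne_eq_zero fun k hk => ?_
  obtain ⟨j, rfl | rfl | rfl | rfl | rfl⟩ := int_exists_five_mul_add k <;> push_cast at hk <;>
    ring_nf at hk <;> lia

/-- A pentagonal number is 1 mod 5 only for index 5j+1, and it is then 25·j(3j+1)/2 + 1, hence 1 mod
25. -/
lemma pNegOne_five_mul_add_one {n : ℕ} (hn : ¬ 5 ∣ n) : pNegOne (5 * n + 1) = 0 := by
  refine pNegOne_eq_zero fun k hk => ?_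
  obtain ⟨j, rfl | rfl | rfl | rfl | rfl⟩ := int_exists_five_mul_add k <;> push_cast at hk <;>
    ring_nf at hk <;> lia

/-- With 24n+1 = (6k-1)², one has 24(25n+1)+1 = (5(6k-1))² = (6(1-5k)-1)². The index 1-5k has parity
opposite to k, whence the sign. -/
lemma pNegOne_twentyFive_mul_add_one (n : ℕ) : pNegOne (25 * n + 1) = -pNegOne n := by
  by_cases h : ∃ k : ℤ, (k * (3 * k - 1) : ℤ) = 2 * n
  · obtain ⟨k, hk⟩ := h
    have h2 : (1 - 5 * k) * (3 * (1 - 5 * k) - 1) = 2 * ((25 * n + 1 : ℕ) : ℤ) := by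
      push_cast; linarith
    rw [pNegOne_of_eq hk, pNegOne_of_eq h2, Int.negOnePow_sub, Int.negOnePow_one]
    have : (5 * k).negOnePow = k.negOnePow := by
      rw [show 5 * k = k + 2 * (2 * k) by ring, Int.negOnePow_add, Int.negOnePow_two_mul, mul_one]
    rw [this]
    simp
  · rw [pNegOne_eq_zero (n := n) (by simpa using h), neg_zero]
    refine pNegOne_eq_zero ?_
    intro k hk
    push_cast at hk
    obtain ⟨j, rfl | rfl | rfl | rfl | rfl⟩ := int_exists_five_mul_add k
    · ring_nf at hk; lia
    · refine h ⟨-j, ?_⟩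
      linarith
    all_goals ring_nf at hk; lia

/-! ### The Rogers functions and the Rogers–Ramanujan continued fraction -/

/-- The exponent `r (5 r + 1) / 2`. -/
def rogersExp (r : ℕ) : ℕ := r * (5 * r + 1) / 2

lemma two_mul_rogersExp (r : ℕ) : 2 * rogersExp r = r * (5 * r + 1) :=
  Nat.two_mul_div_two_of_even (by grind)

lemma rogersExp_succ (r : ℕ) : rogersExp (r + 1) = rogersExp r + (5 * r + 3) := by
  have h1 := two_mul_rogersExp r
  have h2 := two_mul_rogersExp (r + 1)
  nlinarith

lemma le_rogersExp (r : ℕ) : r ≤ rogersExp r := by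
  have h1 := two_mul_rogersExp r
  rcases Nat.eq_zero_or_pos r with rfl | h
  · simp
  · nlinarith

/-- The product `∏_{j < k} (1 - q ^ (r + j + 1))`. -/
noncomputable def rogersProd (q : ℂ) (k r : ℕ) : ℂ :=
  ∏ j ∈ Finset.range k, (1 - q ^ (r + j + 1))

lemma rogersProd_succ (q : ℂ) (k r : ℕ) :
    rogersProd q (k + 1) r = rogersProd q k r * (1 - q ^ (r + k + 1)) :=
  Finset.prod_range_succ _ _

lemma rogersProd_succ' (q : ℂ) (k r : ℕ) :
    rogersProd q (k + 1) r = (1 - q ^ (r + 1)) * rogersProd q k (r + 1) := by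
  rw [rogersProd, Finset.prod_range_succ', mul_comm, rogersProd]
  congr 1
  exact Finset.prod_congr rfl fun j _ => by ring_nf

/-- The terms of `(q; q)_∞` times Rogers' function `H₂` at `q ^ (k + 1)`. -/
noncomputable def rogersTerm (q : ℂ) (k r : ℕ) : ℂ :=
  (-1) ^ r * (q ^ (rogersExp r + 2 * r * k) * (1 - q ^ (2 * (k + 1 + 2 * r))) * rogersProd q k r)

/-- The terms of `(q; q)_∞` times Rogers' function `H₁` at `q ^ (k + 1)`. -/
noncomputable def rogersTermAux (q : ℂ) (k r : ℕ) : ℂ :=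
  (-1) ^ r * (q ^ (rogersExp r + 2 * r * k + r) * (1 - q ^ (k + 1 + 2 * r)) * rogersProd q k r)

/-- `(q; q)_∞` times Rogers' function `H₂` at `q ^ (k + 1)`; that is, `(q; q)_∞` times
`∑ q ^ (n ^ 2 + k n) / (q; q)_n`. -/
noncomputable def rogersSum (q : ℂ) (k : ℕ) : ℂ := ∑' r, rogersTerm q k r

lemma norm_rogers_bound {q : ℂ} (hq : ‖q‖ < 1) {m k r a n : ℕ} (h : n ≤ a) :
    ‖(-1) ^ r * (q ^ a * (1 - q ^ m) * rogersProd q k r)‖ ≤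
      ‖q‖ ^ n * (2 * Real.exp (1 - ‖q‖)⁻¹) := by
  rw [norm_neg_one_pow_mul, norm_mul, norm_mul, norm_pow, mul_assoc]
  have h1 : ‖1 - q ^ m‖ ≤ 2 := by
    refine (norm_sub_le _ _).trans ?_
    rw [norm_one, norm_pow]
    linarith [pow_le_one₀ (n := m) (norm_nonneg q) hq.le]
  exact mul_le_mul (pow_le_pow_of_le_one (norm_nonneg _) hq.le h)
    (mul_le_mul h1 (norm_prod_one_sub_pow_le hq _ _) (norm_nonneg _) zero_le_two)
    (by positivity) (by positivity)

lemma summable_rogers_bound {q : ℂ} (hq : ‖q‖ < 1) :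
    Summable fun r : ℕ => ‖q‖ ^ r * (2 * Real.exp (1 - ‖q‖)⁻¹) :=
  (summable_norm_pow hq).mul_right _

lemma norm_rogersTerm_le {q : ℂ} (hq : ‖q‖ < 1) (k r : ℕ) :
    ‖rogersTerm q k r‖ ≤ ‖q‖ ^ r * (2 * Real.exp (1 - ‖q‖)⁻¹) :=
  norm_rogers_bound hq ((le_rogersExp r).trans (Nat.le_add_right _ _))

lemma summable_rogersTerm {q : ℂ} (hq : ‖q‖ < 1) (k : ℕ) : Summable (rogersTerm q k) :=
  .of_norm_bounded (summable_rogers_bound hq) (norm_rogersTerm_le hq k)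

lemma summable_rogersTermAux {q : ℂ} (hq : ‖q‖ < 1) (k : ℕ) : Summable (rogersTermAux q k) :=
  .of_norm_bounded (summable_rogers_bound hq) fun _ =>
    norm_rogers_bound hq (Nat.le_add_left _ _)

lemma tsum_eq_zero_of_telescope {f V : ℕ → ℂ} (hf : Summable f) (h : ∀ r, f r = V r - V (r + 1))
    (h0 : V 0 = 0) (hV : Tendsto V atTop (𝓝 0)) : ∑' r, f r = 0 := by
  have h1 : ∀ N, ∑ r ∈ Finset.range N, f r = -V N := fun N => by
    rw [Finset.sum_congr rfl fun r _ => h r, Finset.sum_range_sub', h0, zero_sub]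
  refine tendsto_nhds_unique hf.hasSum.tendsto_sum_nat ?_
  simpa only [h1, neg_zero] using hV.neg

/-- This is H₁(x) = H₂(xq) at x = q^(k+1), one of the two relations behind Rogers' recurrence. -/
lemma tsum_rogersTermAux {q : ℂ} (hq : ‖q‖ < 1) (k : ℕ) :
    ∑' r, rogersTermAux q k r = rogersSum q (k + 1) := by
  rw [rogersSum, ← sub_eq_zero,
    ← (summable_rogersTermAux hq k).tsum_sub (summable_rogersTerm hq (k + 1))]
  refine tsum_eq_zero_of_telescope
    -- The telescoping comes from 1 - q^(k+1+2r) = (1 - q^r) + q^r(1 - q^(r+k+1)): the first part is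
    -- V r, and the factor 1 - q^(r+k+1) lengthens the product, which can then be peeled from the
    -- other end. The factor 1 - q^r makes V 0 vanish.
    (V := fun r => (-1) ^ r * (q ^ (rogersExp r + 2 * r * k + r) * (1 - q ^ r) * rogersProd q k r))
    ((summable_rogersTermAux hq k).sub (summable_rogersTerm hq (k + 1))) (fun r => ?_) (by simp) ?_
  · have h1 := rogersProd_succ q k r
    have h2 := rogersProd_succ' q k r
    rw [rogersTermAux, rogersTerm, rogersExp_succ, h1]
    rw [h1] at h2
    linear_combination (-1) ^ r * q ^ (rogersExp r + 2 * r * k + 6 * r + 2 * k + 4) * h2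
  · exact squeeze_zero_norm (fun _ => norm_rogers_bound hq (Nat.le_add_left _ _))
      (summable_rogers_bound hq).tendsto_atTop_zero

/-- The second relation, H₂(x) = H₁(x) + x·H₁(xq), again by termwise telescoping. -/
lemma rogersSum_eq_aux {q : ℂ} (hq : ‖q‖ < 1) (k : ℕ) :
    rogersSum q k = ∑' r, rogersTermAux q k r + q ^ (k + 1) * ∑' r, rogersTermAux q (k + 1) r := by
  have hs := ((summable_rogersTerm hq k).sub (summable_rogersTermAux hq k))
  have hs' := (summable_rogersTermAux hq (k + 1)).mul_left (q ^ (k + 1))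
  rw [rogersSum, ← sub_eq_iff_eq_add', ← sub_eq_zero, ← tsum_mul_left,
    ← (summable_rogersTerm hq k).tsum_sub (summable_rogersTermAux hq k), ← hs.tsum_sub hs']
  refine tsum_eq_zero_of_telescope
    (V := fun r => (-1) ^ r * (q ^ (rogersExp r + 2 * r * k) * (1 - q ^ r) * rogersProd q k r))
    (hs.sub hs') (fun r => ?_) (by simp) ?_
  · have h1 := rogersProd_succ q k r
    have h2 := rogersProd_succ' q k r
    rw [rogersTermAux, rogersTermAux, rogersTerm, rogersExp_succ, h1]
    rw [h1] at h2
    linear_combination (-1) ^ r * q ^ (rogersExp r + 2 * r * k + 5 * r + 2 * k + 3) * h2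
  · exact squeeze_zero_norm (fun r => norm_rogers_bound hq
      ((le_rogersExp r).trans (Nat.le_add_right _ _))) (summable_rogers_bound hq).tendsto_atTop_zero

/-- Rogers' recurrence. -/
theorem rogersSum_recurrence {q : ℂ} (hq : ‖q‖ < 1) (k : ℕ) :
    rogersSum q k = rogersSum q (k + 1) + q ^ (k + 1) * rogersSum q (k + 2) := by
  rw [rogersSum_eq_aux hq, tsum_rogersTermAux hq, tsum_rogersTermAux hq]

theorem tendsto_rogersSum {q : ℂ} (hq : ‖q‖ < 1) :
    Tendsto (rogersSum q) atTop (𝓝 (qPochInf q q)) := by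
  have hpow := tendsto_pow_atTop_nhds_zero_of_norm_lt_one hq
  -- Only the term r = 0 survives as k → ∞: for r ≥ 1 the exponent is at least 2rk.
  rw [← tsum_ite_eq 0 (fun _ : ℕ => qPochInf q q)]
  refine tendsto_tsum_of_dominated_convergence (summable_rogers_bound hq) (fun r => ?_)
    (.of_forall fun k => norm_rogersTerm_le hq k)
  rcases Nat.eq_zero_or_pos r with rfl | hr
  · have h1 : Tendsto (fun k : ℕ => 1 - q ^ (2 * (k + 1))) atTop (𝓝 (1 - 0)) :=
      (hpow.comp (tendsto_atTop_mono (fun k => by simp only [id]; lia) tendsto_id)).const_sub 1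
    simpa [rogersTerm, rogersExp, rogersProd] using
      h1.mul (hasProd_qPochInf_self hq).tendsto_prod_nat
  · rw [if_neg hr.ne']
    refine squeeze_zero_norm (a := fun k => ‖q‖ ^ k * (2 * Real.exp (1 - ‖q‖)⁻¹)) (fun k => ?_) ?_
    · exact norm_rogers_bound hq (by nlinarith)
    · rw [← zero_mul (2 * Real.exp (1 - ‖q‖)⁻¹)]
      exact (tendsto_pow_atTop_nhds_zero_of_lt_one (norm_nonneg _) hq).mul_const _

/-- Two consecutive zeros propagate upwards through the recurrence because q ≠ 0, contradicting the
nonzero limit `qPochInf q q`. -/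
lemma not_rogersSum_zero_one_eq_zero {q : ℂ} (hq0 : q ≠ 0) (hq : ‖q‖ < 1) (h0 : rogersSum q 0 = 0)
    (h1 : rogersSum q 1 = 0) : False := by
  have h : ∀ k, rogersSum q k = 0 ∧ rogersSum q (k + 1) = 0 := by
    intro k
    induction k with
    | zero => exact ⟨h0, h1⟩
    | succ k ih =>
      refine ⟨ih.2, ?_⟩
      have := rogersSum_recurrence hq k
      rw [ih.1, ih.2, zero_add] at this
      exact (mul_eq_zero.mp this.symm).resolve_left (pow_ne_zero _ hq0)
  refine qPochInf_self_ne_zero hq (tendsto_nhds_unique (tendsto_rogersSum hq) ?_)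
  exact tendsto_const_nhds.congr fun k => (h k).1.symm

/-- A sequence satisfying the recurrence of the continuants of the Rogers–Ramanujan continued
fraction converges, with a limit given by Rogers' functions. -/
lemma tendsto_continuant {q : ℂ} (hq : ‖q‖ < 1) {a : ℕ → ℂ}
    (ha : ∀ n, a (n + 2) = a (n + 1) + q ^ (n + 1) * a n) :
    Tendsto a atTop
      (𝓝 ((a 1 * rogersSum q 1 + q * a 0 * rogersSum q 2) / qPochInf q q)) := by
  set L := a 1 * rogersSum q 1 + q * a 0 * rogersSum q 2
  -- The continuants run forwards and Rogers' recurrence backwards with the same coefficients, so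
  -- this pairing is constant in n. Once a is known to be bounded, its second summand tends to 0 and
  -- the limit of a can be read off.
  have hinv : ∀ n, a (n + 1) * rogersSum q (n + 1) + q ^ (n + 1) * a n * rogersSum q (n + 2) = L := by
    intro n
    induction n with
    | zero => simp [L]
    | succ n ih =>
      rw [← ih, ha, rogersSum_recurrence hq (n + 1)]
      ring
  -- Each step enlarges the maximum by a factor at most 1 + ‖q‖^n, and the product of these factors
  -- converges.
  have hbound : ∀ n, max ‖a n‖ ‖a (n + 1)‖ ≤
      max ‖a 0‖ ‖a 1‖ * ∏ i ∈ Finset.range n, (1 + ‖q‖ ^ i) := by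
    intro n
    induction n with
    | zero => simp
    | succ n ih =>
      rw [Finset.prod_range_succ, ← mul_assoc]
      refine le_trans ?_ (mul_le_mul_of_nonneg_right ih (by positivity))
      have h1 := le_max_left ‖a n‖ ‖a (n + 1)‖
      have h2 := le_max_right ‖a n‖ ‖a (n + 1)‖
      have h3 : 0 ≤ ‖q‖ ^ n := by positivity
      refine max_le (by nlinarith [norm_nonneg (a n)]) ?_
      rw [ha]
      refine (norm_add_le _ _).trans ?_
      rw [norm_mul, norm_pow]
      have h4 : ‖q‖ ^ (n + 1) ≤ ‖q‖ ^ n := pow_le_pow_of_le_one (norm_nonneg _) hq.le n.le_succ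
      nlinarith [norm_nonneg (a n)]
  set C := max ‖a 0‖ ‖a 1‖ * Real.exp (1 - ‖q‖)⁻¹
  have hC : ∀ n, ‖a n‖ ≤ C := by
    intro n
    refine (le_max_left _ _).trans ((hbound n).trans ?_)
    refine mul_le_mul_of_nonneg_left ?_ (by positivity)
    refine (Real.prod_one_add_le_exp_sum _ fun i => by positivity).trans ?_
    rw [← tsum_geometric_of_lt_one (norm_nonneg _) hq]
    exact Real.exp_le_exp.mpr ((summable_norm_pow hq).sum_le_tsum _ fun _ _ => by positivity)
  have hE := qPochInf_self_ne_zero hq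
  have hy := tendsto_rogersSum hq
  have h0 : Tendsto (fun n => q ^ (n + 1) * a n) atTop (𝓝 0) := by
    refine squeeze_zero_norm (a := fun n => ‖q‖ ^ n * C) (fun n => ?_) ?_
    · rw [norm_mul, norm_pow]
      exact mul_le_mul (pow_le_pow_of_le_one (norm_nonneg _) hq.le n.le_succ) (hC n)
        (norm_nonneg _) (by positivity)
    · rw [← zero_mul C]
      exact (tendsto_pow_atTop_nhds_zero_of_lt_one (norm_nonneg _) hq).mul_const _
  have h1 : Tendsto (fun n => a (n + 1) * rogersSum q (n + 1)) atTop (𝓝 L) := by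
    have h2 := (h0.mul ((tendsto_add_atTop_iff_nat 2).mpr hy)).const_sub L
    rw [zero_mul, sub_zero] at h2
    refine h2.congr fun n => ?_
    rw [← hinv n]
    ring
  have h2 : Tendsto (fun n => a n * rogersSum q n) atTop (𝓝 L) := (tendsto_add_atTop_iff_nat 1).mp h1
  refine (h2.div hy hE).congr' ?_
  filter_upwards [hy.eventually_ne hE] with n hn
  exact mul_div_cancel_right₀ _ hn

/-! ### Convergents of the Rogers–Ramanujan continued fraction. -/

lemma rogersRamanujanFrac_get? (t : ℂ) (n : ℕ) :
    (rogersRamanujanFrac t).s.get? n = some ⟨if n = 0 then t else (t ^ 5) ^ n, 1⟩ := rfl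

lemma tendsto_nums (t : ℂ) (ht : ‖t ^ 5‖ < 1) :
    Tendsto (rogersRamanujanFrac t).nums atTop
      (𝓝 (t * rogersSum (t ^ 5) 1 / qPochInf (t ^ 5) (t ^ 5))) := by
  have h0 : (rogersRamanujanFrac t).nums 0 = 0 := rfl
  have h1 : (rogersRamanujanFrac t).nums 1 = t := by
    rw [GenContFract.first_num_eq (rogersRamanujanFrac_get? t 0)]
    simp [rogersRamanujanFrac]
  have h := tendsto_continuant ht (a := (rogersRamanujanFrac t).nums) fun n => by
    rw [GenContFract.nums_recurrence (rogersRamanujanFrac_get? t (n + 1)) rfl rfl]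
    simp
  simpa [h0, h1] using h

/-- The starting values 1, 1 give the combination `rogersSum q 1 + q * rogersSum q 2` with q = t⁵,
which the recurrence folds into `rogersSum q 0`. -/
lemma tendsto_dens (t : ℂ) (ht : ‖t ^ 5‖ < 1) :
    Tendsto (rogersRamanujanFrac t).dens atTop
      (𝓝 (rogersSum (t ^ 5) 0 / qPochInf (t ^ 5) (t ^ 5))) := by
  have h0 : (rogersRamanujanFrac t).dens 0 = 1 := rfl
  have h1 : (rogersRamanujanFrac t).dens 1 = 1 := by
    rw [GenContFract.first_den_eq (rogersRamanujanFrac_get? t 0)]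
  have h := tendsto_continuant ht (a := (rogersRamanujanFrac t).dens) fun n => by
    rw [GenContFract.dens_recurrence (rogersRamanujanFrac_get? t (n + 1)) rfl rfl]
    simp
  rw [rogersSum_recurrence ht 0]
  simpa [h0, h1] using h

lemma tendsto_convs {t : ℂ} (ht : ‖t ^ 5‖ < 1) (h0 : rogersSum (t ^ 5) 0 ≠ 0) :
    Tendsto (rogersRamanujanFrac t).convs atTop
      (𝓝 (t * rogersSum (t ^ 5) 1 / rogersSum (t ^ 5) 0)) := by
  have hE := qPochInf_self_ne_zero ht
  have h := (tendsto_nums t ht).div (tendsto_dens t ht) (div_ne_zero h0 hE)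
  rw [div_div_div_cancel_right₀ hE] at h
  exact h

lemma rogersRamanujan_eq {t : ℂ} (ht : ‖t ^ 5‖ < 1) (h0 : rogersSum (t ^ 5) 0 ≠ 0) :
    rogersRamanujan t = t * rogersSum (t ^ 5) 1 / rogersSum (t ^ 5) 0 :=
  (tendsto_convs ht h0).limUnder_eq

/-! ### Theta series -/

/-- This is Jacobi's two-variable theta series with τ = log u/(πi) and argument log w/(2πi); Im τ >
0 is the condition ‖u‖ < 1. -/
lemma summable_zpow_sq {u w : ℂ} (hu0 : u ≠ 0) (hu : ‖u‖ < 1) (hw : w ≠ 0) :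
    Summable fun n : ℤ => w ^ n * u ^ (n ^ 2) := by
  have hpi : (Real.pi : ℂ) ≠ 0 := Complex.ofReal_ne_zero.mpr Real.pi_ne_zero
  have hI := Complex.I_ne_zero
  have him : 0 < (Complex.log u / (Real.pi * Complex.I)).im := by
    rw [mul_comm, ← div_div, Complex.div_ofReal_im, Complex.div_I]
    have h2 : (-(Complex.log u * Complex.I)).im = -Real.log ‖u‖ := by simp [Complex.log_re]
    rw [h2]
    exact div_pos (neg_pos.mpr (Real.log_neg (norm_pos_iff.mpr hu0) hu)) Real.pi_pos
  refine ((summable_jacobiTheta₂_term_iff (Complex.log w / (2 * Real.pi * Complex.I)) _).mpr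
    him).congr fun n => ?_
  rw [jacobiTheta₂_term]
  have h1 : 2 * Real.pi * Complex.I * n * (Complex.log w / (2 * Real.pi * Complex.I)) =
      n * Complex.log w := by field_simp
  have h2 : Real.pi * Complex.I * (n : ℂ) ^ 2 * (Complex.log u / (Real.pi * Complex.I)) =
      ((n ^ 2 : ℤ) : ℂ) * Complex.log u := by push_cast; field_simp
  rw [h1, h2, Complex.exp_add, Complex.exp_int_mul, Complex.exp_int_mul, Complex.exp_log hw,
    Complex.exp_log hu0]

/-- The signed monomial `(-1) ^ e * s ^ a * z ^ b`. -/
noncomputable def signedMonomial (s z : ℂ) (e a b : ℤ) : ℂ := (-1) ^ e * s ^ a * z ^ b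

lemma signedMonomial_mul {s z : ℂ} (hs : s ≠ 0) (hz : z ≠ 0) (e a b e' a' b' : ℤ) :
    signedMonomial s z e a b * signedMonomial s z e' a' b' =
      signedMonomial s z (e + e') (a + a') (b + b') := by
  simp only [signedMonomial]
  rw [zpow_add₀ (by simp), zpow_add₀ hs, zpow_add₀ hz]
  ring

lemma signedMonomial_congr {s z : ℂ} {e a b e' a' b' : ℤ} (he : Even (e - e')) (ha : a = a')
    (hb : b = b') : signedMonomial s z e a b = signedMonomial s z e' a' b' := by
  simp only [signedMonomial]
  rw [← sub_add_cancel e e', zpow_add₀ (by simp), he.neg_one_zpow, one_mul, ha, hb]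

lemma signedMonomial_congr_neg {s z : ℂ} {e a b e' a' b' : ℤ} (he : Odd (e - e')) (ha : a = a')
    (hb : b = b') : signedMonomial s z e a b = -signedMonomial s z e' a' b' := by
  simp only [signedMonomial]
  rw [← sub_add_cancel e e', zpow_add₀ (by simp), he.neg_one_zpow, ha, hb]
  ring

lemma summable_signedMonomial {s z : ℂ} (hs0 : s ≠ 0) (hs : ‖s‖ < 1) (hz : z ≠ 0) {a : ℕ}
    (ha : a ≠ 0) (b c d : ℤ) :
    Summable fun n : ℤ => signedMonomial s z n (a * n ^ 2 + b * n) (c * n + d) := by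
  have h : -(s ^ b * z ^ c) ≠ 0 :=
    neg_ne_zero.mpr (mul_ne_zero (zpow_ne_zero _ hs0) (zpow_ne_zero _ hz))
  have hn : ‖s ^ a‖ < 1 := by rw [norm_pow]; exact pow_lt_one₀ (norm_nonneg _) hs ha
  refine ((summable_zpow_sq (pow_ne_zero a hs0) hn h).mul_right (z ^ d)).congr fun n => ?_
  rw [signedMonomial, zpow_add₀ hs0, zpow_add₀ hz, neg_eq_neg_one_mul, mul_zpow, mul_zpow,
    zpow_mul, zpow_mul, zpow_mul, zpow_natCast]
  ring

lemma tsum_prod_even_add_odd {φ : ℤ × ℤ → ℂ} (h : Summable φ) :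
    ∑' p, φ p = ∑' p : ℤ × ℤ, φ (p.1, 2 * p.2) + ∑' p : ℤ × ℤ, φ (p.1, 2 * p.2 + 1) := by
  have h0 : Function.Injective fun p : ℤ × ℤ => (p.1, 2 * p.2) := by
    rintro ⟨a, b⟩ ⟨c, d⟩ h
    simp only [Prod.mk.injEq] at h ⊢
    lia
  have h1 : Function.Injective fun p : ℤ × ℤ => (p.1, 2 * p.2 + 1) := by
    rintro ⟨a, b⟩ ⟨c, d⟩ h
    simp only [Prod.mk.injEq] at h ⊢
    lia
  have hc : IsCompl (Set.range fun p : ℤ × ℤ => (p.1, 2 * p.2))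
      (Set.range fun p : ℤ × ℤ => (p.1, 2 * p.2 + 1)) := by
    constructor
    · rw [Set.disjoint_left]
      rintro _ ⟨⟨a, b⟩, rfl⟩ ⟨⟨c, d⟩, h⟩
      simp only [Prod.mk.injEq] at h
      lia
    · rw [codisjoint_iff]
      refine Set.eq_univ_iff_forall.mpr ?_
      rintro ⟨a, b⟩
      rcases Int.even_or_odd' b with ⟨c, rfl | rfl⟩
      · exact Or.inl ⟨(a, c), rfl⟩
      · exact Or.inr ⟨(a, c), rfl⟩
  have e0 := (h.comp_injective h0).hasSum
  have e1 := (h.comp_injective h1).hasSum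
  rw [← h0.hasSum_range_iff] at e0
  rw [← h1.hasSum_range_iff] at e1
  exact (e0.add_isCompl hc e1).tsum_eq

/-- A form of the quintuple product identity, with the theta series in place of the products:
`q = s ^ 2`. -/
theorem quintuple_theta {s z : ℂ} (hs0 : s ≠ 0) (hs : ‖s‖ < 1) (hz : z ≠ 0) :
    (∑' n : ℤ, signedMonomial s z n (n * (3 * n - 1)) (3 * n) +
      ∑' n : ℤ, signedMonomial s z n (n * (3 * n - 1)) (1 - 3 * n)) *
      ∑' n : ℤ, signedMonomial s z n (n * (n - 1)) n =
    (∑' n : ℤ, signedMonomial s z n (n * (3 * n - 1)) 0) *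
      ∑' n : ℤ, signedMonomial s z n (n * (n - 1)) (2 * n) := by
  set f := fun n : ℤ => signedMonomial s z n (n * (3 * n - 1)) (3 * n)
  set f' := fun n : ℤ => signedMonomial s z n (n * (3 * n - 1)) (1 - 3 * n)
  set g := fun n : ℤ => signedMonomial s z n (n * (n - 1)) n
  set e := fun n : ℤ => signedMonomial s z n (n * (3 * n - 1)) 0
  set g' := fun n : ℤ => signedMonomial s z n (n * (n - 1)) (2 * n)
  have hf : Summable fun n => ‖f n‖ :=
    ((summable_signedMonomial hs0 hs hz three_ne_zero (-1) 3 0).congr fun n =>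
      signedMonomial_congr (by simp) (by push_cast; ring) (by ring)).norm
  have hf' : Summable fun n => ‖f' n‖ :=
    ((summable_signedMonomial hs0 hs hz three_ne_zero (-1) (-3) 1).congr fun n =>
      signedMonomial_congr (by simp) (by push_cast; ring) (by ring)).norm
  have hg : Summable fun n => ‖g n‖ :=
    ((summable_signedMonomial hs0 hs hz one_ne_zero (-1) 1 0).congr fun n =>
      signedMonomial_congr (by simp) (by push_cast; ring) (by ring)).norm
  have he : Summable fun n => ‖e n‖ :=
    ((summable_signedMonomial hs0 hs hz three_ne_zero (-1) 0 0).congr fun n =>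
      signedMonomial_congr (by simp) (by push_cast; ring) (by ring)).norm
  have hg' : Summable fun n => ‖g' n‖ :=
    ((summable_signedMonomial hs0 hs hz one_ne_zero (-1) 2 0).congr fun n =>
      signedMonomial_congr (by simp) (by push_cast; ring) (by ring)).norm
  rw [add_mul, tsum_mul_tsum_of_summable_norm hf hg, tsum_mul_tsum_of_summable_norm hf' hg,
    tsum_mul_tsum_of_summable_norm he hg']
  have sF := summable_mul_of_summable_norm hf hg
  have sF' := summable_mul_of_summable_norm hf' hg
  have sW := summable_mul_of_summable_norm he hg'
  -- `e1` and `e2` make the second coordinate the exponent of z in the products f·g and f'·g, so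
  -- that splitting by its parity separates even and odd powers of z.
  let e1 : ℤ × ℤ ≃ ℤ × ℤ :=
    ⟨fun p => (p.1, p.2 - 3 * p.1), fun p => (p.1, p.2 + 3 * p.1), fun _ => by ext <;> grind,
      fun _ => by ext <;> grind⟩
  let e2 : ℤ × ℤ ≃ ℤ × ℤ :=
    ⟨fun p => (p.1, p.2 - 1 + 3 * p.1), fun p => (p.1, p.2 + 1 - 3 * p.1), fun _ => by ext <;> grind,
      fun _ => by ext <;> grind⟩
  -- On the right the exponent of z is always even, namely twice the first coordinate. The parity of
  -- the second coordinate, the difference of the two indices, decides whether a term matches one of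
  -- f·g or of f'·g.
  let e3 : ℤ × ℤ ≃ ℤ × ℤ :=
    ⟨fun p => (p.1 - p.2, p.1), fun p => (p.2, p.2 - p.1), fun _ => by ext <;> grind,
      fun _ => by ext <;> grind⟩
  let e4 : ℤ × ℤ ≃ ℤ × ℤ :=
    ⟨fun p => (p.1 + p.2, p.2), fun p => (p.1 - p.2, p.2), fun _ => by ext <;> grind,
      fun _ => by ext <;> grind⟩
  let e5 : ℤ × ℤ ≃ ℤ × ℤ :=
    ⟨fun p => (p.2, p.1), fun p => (p.2, p.1), fun p => by simp, fun p => by simp⟩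
  let e6 : ℤ × ℤ ≃ ℤ × ℤ :=
    ⟨fun p => (p.2, p.1 + p.2 - 1), fun p => (p.2 - p.1 + 1, p.1), fun _ => by ext <;> grind,
      fun _ => by ext <;> grind⟩
  rw [← e1.tsum_eq (fun p : ℤ × ℤ => f p.1 * g p.2),
    ← e2.tsum_eq (fun p : ℤ × ℤ => f' p.1 * g p.2),
    ← e3.tsum_eq (fun p : ℤ × ℤ => e p.1 * g' p.2)]
  have k1 := tsum_prod_even_add_odd (e1.summable_iff.mpr sF)
  have k2 := tsum_prod_even_add_odd (e2.summable_iff.mpr sF')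
  have k3 := tsum_prod_even_add_odd (e3.summable_iff.mpr sW)
  simp only [Function.comp_apply] at k1 k2 k3
  rw [k1, k2, k3]
  -- The odd powers of z cancel between the two products on the left.
  have o : ∑' p : ℤ × ℤ, f (e1 (p.1, 2 * p.2 + 1)).1 * g (e1 (p.1, 2 * p.2 + 1)).2 =
      -∑' p : ℤ × ℤ, f' (e2 (p.1, 2 * p.2 + 1)).1 * g (e2 (p.1, 2 * p.2 + 1)).2 := by
    rw [← e4.tsum_eq, ← tsum_neg]
    refine tsum_congr fun ⟨n, m⟩ => ?_
    simp only [e1, e2, e4, f, f', g, Equiv.coe_fn_mk]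
    rw [signedMonomial_mul hs0 hz, signedMonomial_mul hs0 hz]
    exact signedMonomial_congr_neg (by grind) (by ring) (by ring)
  have h1 : ∑' p : ℤ × ℤ, f (e1 (p.1, 2 * p.2)).1 * g (e1 (p.1, 2 * p.2)).2 =
      ∑' p : ℤ × ℤ, e (e3 (p.1, 2 * p.2)).1 * g' (e3 (p.1, 2 * p.2)).2 := by
    rw [← e5.tsum_eq]
    refine tsum_congr fun ⟨n, m⟩ => ?_
    simp only [e1, e3, e5, f, e, g, g', Equiv.coe_fn_mk]
    rw [signedMonomial_mul hs0 hz, signedMonomial_mul hs0 hz]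
    exact signedMonomial_congr (by grind) (by ring) (by ring)
  have h2 : ∑' p : ℤ × ℤ, f' (e2 (p.1, 2 * p.2)).1 * g (e2 (p.1, 2 * p.2)).2 =
      ∑' p : ℤ × ℤ, e (e3 (p.1, 2 * p.2 + 1)).1 * g' (e3 (p.1, 2 * p.2 + 1)).2 := by
    rw [← e6.tsum_eq (fun p : ℤ × ℤ => e (e3 (p.1, 2 * p.2 + 1)).1 * g' (e3 (p.1, 2 * p.2 + 1)).2)]
    refine tsum_congr fun ⟨n, m⟩ => ?_
    simp only [e2, e3, e6, f', e, g, g', Equiv.coe_fn_mk]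
    rw [signedMonomial_mul hs0 hz, signedMonomial_mul hs0 hz]
    exact signedMonomial_congr (by grind) (by ring) (by ring)
  linear_combination o + h1 + h2

/-! ### The 5-dissection of Euler's product -/

lemma neg_one_zpow_congr {a b : ℤ} (h : Even (a - b)) : (-1 : ℂ) ^ a = (-1) ^ b := by
  rw [← sub_add_cancel a b, zpow_add₀ (by simp), h.neg_one_zpow, one_mul]

lemma sq_pow_eq_zpow {s : ℂ} {m : ℕ} {a : ℤ} (h : 2 * (m : ℤ) = a) : (s ^ 2) ^ m = s ^ a := by
  rw [← h, ← pow_mul]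
  exact_mod_cast (zpow_natCast s (2 * m)).symm

lemma signedMonomial_pow {s : ℂ} (hs : s ≠ 0) (m c : ℕ) (e a b : ℤ) :
    signedMonomial (s ^ m) (s ^ c) e a b = (-1) ^ e * s ^ (m * a + c * b) := by
  rw [signedMonomial, zpow_add₀ hs, zpow_mul, zpow_mul, zpow_natCast, zpow_natCast, mul_assoc]

lemma summable_theta {s : ℂ} (hs0 : s ≠ 0) (hs : ‖s‖ < 1) (b : ℤ) :
    Summable fun n : ℤ => (-1) ^ n * s ^ (5 * n ^ 2 + b * n) := by
  refine (summable_signedMonomial hs0 hs one_ne_zero (a := 5) (by simp) b 0 0).congr fun n => ?_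
  simp [signedMonomial]

/-- The theta series for `∑ q ^ (n ^ 2) / (q; q)_n`, with `q = s ^ 2`. -/
lemma tsum_theta_one {s : ℂ} (hs0 : s ≠ 0) (hs : ‖s‖ < 1) :
    ∑' n : ℤ, (-1) ^ n * s ^ (5 * n ^ 2 + 1 * n) = rogersSum (s ^ 2) 0 := by
  rw [rogersSum, ← (summable_theta hs0 hs 1).hasSum.nat_add_neg_add_one.tsum_eq]
  refine tsum_congr fun r => ?_
  have h := two_mul_rogersExp r
  have h1 : (s ^ 2) ^ (rogersExp r) = s ^ (5 * (r : ℤ) ^ 2 + 1 * r) :=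
    sq_pow_eq_zpow (by zify at h; linarith)
  have h2 : (s ^ 2) ^ (rogersExp r + (2 + 4 * r)) =
      s ^ (5 * (-((r : ℤ) + 1)) ^ 2 + 1 * (-((r : ℤ) + 1))) :=
    sq_pow_eq_zpow (by zify at h; push_cast; linarith)
  have h3 : (-1 : ℂ) ^ (-((r : ℤ) + 1)) = -(-1) ^ r := by
    rw [neg_one_zpow_congr (b := (r : ℤ) + 1) (by grind), zpow_add₀ (by simp), zpow_natCast]
    simp
  rw [← h1, ← h2, h3, rogersTerm, rogersProd, zpow_natCast]
  simp only [Finset.range_zero, Finset.prod_empty]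
  ring

/-- The theta series for `∑ q ^ (n ^ 2 + n) / (q; q)_n`, with `q = s ^ 2`. -/
lemma tsum_theta_three {s : ℂ} (hs0 : s ≠ 0) (hs : ‖s‖ < 1) :
    ∑' n : ℤ, (-1) ^ n * s ^ (5 * n ^ 2 + 3 * n) = rogersSum (s ^ 2) 1 := by
  have hq : ‖s ^ 2‖ < 1 := by rw [norm_pow]; exact pow_lt_one₀ (norm_nonneg _) hs two_ne_zero
  -- The H₁ form at k = 0 has an empty product, so each of its terms is just the pair of theta terms
  -- with indices r and -(r+1).
  rw [← tsum_rogersTermAux hq 0, ← (summable_theta hs0 hs 3).hasSum.nat_add_neg_add_one.tsum_eq]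
  refine tsum_congr fun r => ?_
  have h := two_mul_rogersExp r
  have h1 : (s ^ 2) ^ (rogersExp r + r) = s ^ (5 * (r : ℤ) ^ 2 + 3 * r) :=
    sq_pow_eq_zpow (by zify at h; push_cast; linarith)
  have h2 : (s ^ 2) ^ (rogersExp r + r + (1 + 2 * r)) =
      s ^ (5 * (-((r : ℤ) + 1)) ^ 2 + 3 * (-((r : ℤ) + 1))) :=
    sq_pow_eq_zpow (by zify at h; push_cast; linarith)
  have h3 : (-1 : ℂ) ^ (-((r : ℤ) + 1)) = -(-1) ^ r := by
    rw [neg_one_zpow_congr (b := (r : ℤ) + 1) (by grind), zpow_add₀ (by simp), zpow_natCast]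
    simp
  rw [← h1, ← h2, h3, rogersTermAux, rogersProd, zpow_natCast]
  simp only [Finset.range_zero, Finset.prod_empty]
  ring

lemma tsum_theta_neg (s : ℂ) (b : ℤ) :
    ∑' n : ℤ, (-1) ^ n * s ^ (5 * n ^ 2 + -b * n) =
      ∑' n : ℤ, (-1) ^ n * s ^ (5 * n ^ 2 + b * n) := by
  rw [← (Equiv.neg ℤ).tsum_eq]
  refine tsum_congr fun n => ?_
  rw [Equiv.neg_apply, neg_one_zpow_congr (b := n) (by grind)]
  congr 2
  ring

/-- If the pentagonal numbers congruent to `c` modulo 5 are those with index congruent to `u` or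
`v`, the corresponding part of Euler's product is a sum of two theta series. -/
lemma tsum_pNegOne_residue {q : ℂ} (hq : ‖q‖ < 1) {c : ℕ} {u v : ℤ}
    (hu : ∀ j : ℤ, pentagonal (u - 5 * j) % 5 = c) (hv : ∀ j : ℤ, pentagonal (v - 5 * j) % 5 = c)
    (huv : ¬ 5 ∣ u - v) (hc : ∀ k : ℤ, pentagonal k % 5 = c → 5 ∣ u - k ∨ 5 ∣ v - k) :
    ∑' n : ℕ, (pNegOne (5 * n + c) : ℂ) * q ^ n =
      ∑' j : ℤ, (-1) ^ (u - 5 * j) * q ^ (pentagonal (u - 5 * j) / 5) +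
        ∑' j : ℤ, (-1) ^ (v - 5 * j) * q ^ (pentagonal (v - 5 * j) / 5) := by
  set F := fun n : ℕ => (pNegOne (5 * n + c) : ℂ) * q ^ n
  have hF : Summable F := summable_pNegOne hq fun n => 5 * n + c
  have hinj : ∀ w : ℤ, (∀ j : ℤ, pentagonal (w - 5 * j) % 5 = c) →
      Function.Injective fun j : ℤ => pentagonal (w - 5 * j) / 5 := by
    intro w hw i j hij
    have h : pentagonal (w - 5 * i) = pentagonal (w - 5 * j) := by
      have h1 := hw i
      have h2 := hw j
      simp only at hij
      lia
    have := pentagonal_injective h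
    lia
  have hsum : ∀ w : ℤ, (∀ j : ℤ, pentagonal (w - 5 * j) % 5 = c) →
      HasSum (F ∘ fun j : ℤ => pentagonal (w - 5 * j) / 5)
        (∑' j : ℤ, (-1) ^ (w - 5 * j) * q ^ (pentagonal (w - 5 * j) / 5)) := by
    intro w hw
    have h : ∀ j : ℤ, F (pentagonal (w - 5 * j) / 5) =
        (-1) ^ (w - 5 * j) * q ^ (pentagonal (w - 5 * j) / 5) := by
      intro j
      simp only [F]
      rw [show 5 * (pentagonal (w - 5 * j) / 5) + c = pentagonal (w - 5 * j) by
        have := hw j; lia, pNegOne_pentagonal, negOnePow_cast_eq_zpow]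
    rw [← tsum_congr h]
    exact (hF.comp_injective (hinj w hw)).hasSum
  have eu := (hinj u hu).hasSum_range_iff (f := F) |>.mpr (hsum u hu)
  have ev := (hinj v hv).hasSum_range_iff (f := F) |>.mpr (hsum v hv)
  have hd : Disjoint (Set.range fun j : ℤ => pentagonal (u - 5 * j) / 5)
      (Set.range fun j : ℤ => pentagonal (v - 5 * j) / 5) := by
    rw [Set.disjoint_left]
    rintro _ ⟨i, rfl⟩ ⟨j, hij⟩
    have h : pentagonal (v - 5 * j) = pentagonal (u - 5 * i) := by
      have h1 := hu i
      have h2 := hv j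
      simp only at hij
      lia
    have := pentagonal_injective h
    exact huv (by lia)
  refine ((hasSum_subtype_iff_of_support_subset ?_).mp
    (HasSum.add_disjoint (f := F) hd eu ev)).tsum_eq
  intro n hn
  by_contra hcon
  refine hn ?_
  simp only [F]
  rw [pNegOne_eq_zero, Int.cast_zero, zero_mul]
  intro k hk
  have hp : pentagonal k = 5 * n + c := by
    have := two_mul_natCast_pentagonal k
    lia
  have hc5 : c < 5 := by rw [← hu 0]; exact Nat.mod_lt _ (by simp)
  rcases hc k (by lia) with ⟨j, hj⟩ | ⟨j, hj⟩
  · exact hcon (Or.inl ⟨j, by simp only; rw [← hj, sub_sub_cancel]; lia⟩)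
  · exact hcon (Or.inr ⟨j, by simp only; rw [← hj, sub_sub_cancel]; lia⟩)

lemma tsum_euler_monomial {s : ℂ} (hs0 : s ≠ 0) (hs : ‖s‖ < 1) (c : ℕ) :
    ∑' n : ℤ, signedMonomial (s ^ 5) (s ^ c) n (n * (3 * n - 1)) 0 =
      qPochInf ((s ^ 2) ^ 5) ((s ^ 2) ^ 5) := by
  have hq : ‖(s ^ 2) ^ 5‖ < 1 := by
    rw [← pow_mul, norm_pow]; exact pow_lt_one₀ (norm_nonneg _) hs (by simp)
  rw [← (hasSum_pentagonal hq).tsum_eq]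
  refine tsum_congr fun n => ?_
  rw [signedMonomial_pow hs0, ← pow_mul, sq_pow_eq_zpow (a := 5 * (n * (3 * n - 1)))]
  · simp
  · rw [← two_mul_natCast_pentagonal]; push_cast; ring

/-- The quintuple product identity with q⁵ for q and z = q. The pentagonal numbers divisible by 5
have index 0 or 2 mod 5, and these two classes are the two theta series of its left factor. The
square root s of q clears the halves in the exponents. -/
theorem tsum_pNegOne_five_mul {q : ℂ} (hq0 : q ≠ 0) (hq : ‖q‖ < 1) :
    (∑' n : ℕ, (pNegOne (5 * n) : ℂ) * q ^ n) * rogersSum q 1 =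
      qPochInf (q ^ 5) (q ^ 5) * rogersSum q 0 := by
  obtain ⟨s, rfl⟩ := IsAlgClosed.exists_pow_nat_eq q two_pos
  have hs0 : s ≠ 0 := by rintro rfl; simp at hq0
  have hs : ‖s‖ < 1 := by
    rw [norm_pow] at hq; exact (pow_lt_one_iff_of_nonneg (norm_nonneg _) two_ne_zero).mp hq
  have hs5 : ‖s ^ 5‖ < 1 := by rw [norm_pow]; exact pow_lt_one₀ (norm_nonneg _) hs (by simp)
  have hd := tsum_pNegOne_residue hq (c := 0) (u := 0) (v := 2)
    (fun j => by have := two_mul_natCast_pentagonal (0 - 5 * j); ring_nf at this ⊢; lia)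
    (fun j => by have := two_mul_natCast_pentagonal (2 - 5 * j); ring_nf at this ⊢; lia)
    (by lia) (fun k hk => by
      have h := two_mul_natCast_pentagonal k
      obtain ⟨j, rfl | rfl | rfl | rfl | rfl⟩ := int_exists_five_mul_add k <;> ring_nf at h hk <;> lia)
  have key := quintuple_theta (pow_ne_zero 5 hs0) hs5 (pow_ne_zero 2 hs0)
  rw [tsum_euler_monomial hs0 hs] at key
  have t1 : ∑' n : ℤ, signedMonomial (s ^ 5) (s ^ 2) n (n * (n - 1)) n = rogersSum (s ^ 2) 1 := by
    rw [← tsum_theta_three hs0 hs, ← tsum_theta_neg]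
    refine tsum_congr fun n => ?_
    rw [signedMonomial_pow hs0]
    congr 2; push_cast; ring
  have t2 : ∑' n : ℤ, signedMonomial (s ^ 5) (s ^ 2) n (n * (n - 1)) (2 * n) =
      rogersSum (s ^ 2) 0 := by
    rw [← tsum_theta_one hs0 hs, ← tsum_theta_neg]
    refine tsum_congr fun n => ?_
    rw [signedMonomial_pow hs0]
    congr 2; push_cast; ring
  rw [t1, t2] at key
  rw [← key]
  congr 1
  refine hd.trans (congrArg₂ _ (tsum_congr fun n => ?_) (tsum_congr fun n => ?_))
  · rw [signedMonomial_pow hs0, neg_one_zpow_congr (b := n) (by grind),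
      sq_pow_eq_zpow (a := 15 * n ^ 2 + n)]
    · congr 2; push_cast; ring
    · have := two_mul_natCast_pentagonal (0 - 5 * n); ring_nf at this ⊢; lia
  · rw [signedMonomial_pow hs0, neg_one_zpow_congr (b := n) (by grind),
      sq_pow_eq_zpow (a := 15 * n ^ 2 - 11 * n + 2)]
    · congr 2; push_cast; ring
    · have := two_mul_natCast_pentagonal (2 - 5 * n); ring_nf at this ⊢; lia

/-- The same identity with z = q². The relevant indices are -1 and 3 mod 5; both representatives are
odd, which gives the minus sign. -/
theorem tsum_pNegOne_five_mul_add_two {q : ℂ} (hq0 : q ≠ 0) (hq : ‖q‖ < 1) :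
    (∑' n : ℕ, (pNegOne (5 * n + 2) : ℂ) * q ^ n) * rogersSum q 0 =
      -(qPochInf (q ^ 5) (q ^ 5) * rogersSum q 1) := by
  obtain ⟨s, rfl⟩ := IsAlgClosed.exists_pow_nat_eq q two_pos
  have hs0 : s ≠ 0 := by rintro rfl; simp at hq0
  have hs : ‖s‖ < 1 := by
    rw [norm_pow] at hq; exact (pow_lt_one_iff_of_nonneg (norm_nonneg _) two_ne_zero).mp hq
  have hs5 : ‖s ^ 5‖ < 1 := by rw [norm_pow]; exact pow_lt_one₀ (norm_nonneg _) hs (by simp)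
  have hd := tsum_pNegOne_residue hq (c := 2) (u := -1) (v := 3)
    (fun j => by have := two_mul_natCast_pentagonal (-1 - 5 * j); ring_nf at this ⊢; lia)
    (fun j => by have := two_mul_natCast_pentagonal (3 - 5 * j); ring_nf at this ⊢; lia)
    (by lia) (fun k hk => by
      have h := two_mul_natCast_pentagonal k
      obtain ⟨j, rfl | rfl | rfl | rfl | rfl⟩ := int_exists_five_mul_add k <;> ring_nf at h hk <;> lia)
  have key := quintuple_theta (pow_ne_zero 5 hs0) hs5 (pow_ne_zero 4 hs0)
  rw [tsum_euler_monomial hs0 hs] at key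
  have t1 : ∑' n : ℤ, signedMonomial (s ^ 5) (s ^ 4) n (n * (n - 1)) n = rogersSum (s ^ 2) 0 := by
    rw [← tsum_theta_one hs0 hs, ← tsum_theta_neg]
    refine tsum_congr fun n => ?_
    rw [signedMonomial_pow hs0]
    congr 2; push_cast; ring
  have t2 : ∑' n : ℤ, signedMonomial (s ^ 5) (s ^ 4) n (n * (n - 1)) (2 * n) =
      rogersSum (s ^ 2) 1 := by
    rw [← tsum_theta_three hs0 hs]
    refine tsum_congr fun n => ?_
    rw [signedMonomial_pow hs0]
    congr 2; push_cast; ring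
  rw [t1, t2] at key
  rw [← key, ← neg_mul, neg_add, ← tsum_neg, ← tsum_neg]
  congr 1
  refine hd.trans (congrArg₂ _ (tsum_congr fun n => ?_) (tsum_congr fun n => ?_))
  · rw [signedMonomial_pow hs0, neg_one_zpow_congr (b := n + 1) (by grind),
      sq_pow_eq_zpow (a := 15 * n ^ 2 + 7 * n), zpow_add₀ (by simp), zpow_one, mul_neg_one, neg_mul]
    · congr 3; push_cast; ring
    · have := two_mul_natCast_pentagonal (-1 - 5 * n); ring_nf at this ⊢; lia
  · rw [signedMonomial_pow hs0, neg_one_zpow_congr (b := n + 1) (by grind),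
      sq_pow_eq_zpow (a := 15 * n ^ 2 - 17 * n + 4), zpow_add₀ (by simp), zpow_one, mul_neg_one,
      neg_mul]
    · congr 3; push_cast; ring
    · have := two_mul_natCast_pentagonal (3 - 5 * n); ring_nf at this ⊢; lia

/-- The two dissection identities exchange the roles of the two values, so if either vanished then
so would the other. -/
lemma rogersSum_ne_zero {q : ℂ} (hq0 : q ≠ 0) (hq : ‖q‖ < 1) :
    rogersSum q 0 ≠ 0 ∧ rogersSum q 1 ≠ 0 := by
  have hE : qPochInf (q ^ 5) (q ^ 5) ≠ 0 := qPochInf_self_ne_zero (by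
    rw [norm_pow]; exact pow_lt_one₀ (norm_nonneg _) hq (by simp))
  have hA := tsum_pNegOne_five_mul hq0 hq
  have hB := tsum_pNegOne_five_mul_add_two hq0 hq
  refine ⟨fun h => ?_, fun h => ?_⟩
  · rw [h, mul_zero, eq_comm, neg_eq_zero] at hB
    exact not_rogersSum_zero_one_eq_zero hq0 hq h ((mul_eq_zero.mp hB).resolve_left hE)
  · rw [h, mul_zero, eq_comm] at hA
    exact not_rogersSum_zero_one_eq_zero hq0 hq ((mul_eq_zero.mp hA).resolve_left hE) h

lemma norm_pow_lt_one {q : ℂ} (hq : ‖q‖ < 1) {n : ℕ} (hn : n ≠ 0) : ‖q ^ n‖ < 1 := by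
  rw [norm_pow]; exact pow_lt_one₀ (norm_nonneg _) hq hn

theorem hasSum_pNegOne_five_mul_add_one {q : ℂ} (hq : ‖q‖ < 1) :
    HasSum (fun n : ℕ => (pNegOne (5 * n + 1) : ℂ) * q ^ n) (-qPochInf (q ^ 5) (q ^ 5)) := by
  have hinj : Function.Injective fun n : ℕ => 5 * n := fun a b h => by simpa using h
  rw [← hinj.hasSum_iff (f := fun n : ℕ => (pNegOne (5 * n + 1) : ℂ) * q ^ n)]
  · refine (hasSum_pNegOne (norm_pow_lt_one hq (by simp))).neg.congr_fun fun n => ?_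
    rw [Function.comp_apply, show 5 * (5 * n) + 1 = 25 * n + 1 by ring,
      pNegOne_twentyFive_mul_add_one, pow_mul]
    push_cast
    ring
  · intro n hn
    rw [pNegOne_five_mul_add_one, Int.cast_zero, zero_mul]
    rintro ⟨m, rfl⟩
    exact hn ⟨m, rfl⟩

theorem hasSum_pNegOne_five_mul {q : ℂ} (hq0 : q ≠ 0) (hq : ‖q‖ < 1) :
    HasSum (fun n : ℕ => (pNegOne (5 * n) : ℂ) * q ^ n)
      (qPochInf (q ^ 5) (q ^ 5) * rogersSum q 0 / rogersSum q 1) := by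
  rw [← tsum_pNegOne_five_mul hq0 hq, mul_div_cancel_right₀ _ (rogersSum_ne_zero hq0 hq).2]
  exact (summable_pNegOne hq fun n => 5 * n).hasSum

theorem hasSum_pNegOne_five_mul_add_two {q : ℂ} (hq0 : q ≠ 0) (hq : ‖q‖ < 1) :
    HasSum (fun n : ℕ => (pNegOne (5 * n + 2) : ℂ) * q ^ n)
      (-(qPochInf (q ^ 5) (q ^ 5) * rogersSum q 1) / rogersSum q 0) := by
  rw [← tsum_pNegOne_five_mul_add_two hq0 hq,
    mul_div_cancel_right₀ _ (rogersSum_ne_zero hq0 hq).1]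
  exact (summable_pNegOne hq fun n => 5 * n + 2).hasSum

/-- The 5-dissection of Euler's product. -/
theorem qPochInf_dissection {q : ℂ} (hq0 : q ≠ 0) (hq : ‖q‖ < 1) :
    qPochInf q q =
      qPochInf ((q ^ 5) ^ 5) ((q ^ 5) ^ 5) * rogersSum (q ^ 5) 0 / rogersSum (q ^ 5) 1 -
      q * qPochInf ((q ^ 5) ^ 5) ((q ^ 5) ^ 5) +
      q ^ 2 * (-(qPochInf ((q ^ 5) ^ 5) ((q ^ 5) ^ 5) * rogersSum (q ^ 5) 1) /
        rogersSum (q ^ 5) 0) := by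
  have hq5 := norm_pow_lt_one hq (n := 5) (by simp)
  have h0 := pow_ne_zero 5 hq0
  rw [← (hasSum_pNegOne hq).tsum_eq, Nat.sumByResidueClasses (hasSum_pNegOne hq).summable 5]
  have hterm : ∀ c m : ℕ, (pNegOne (c + 5 * m) : ℂ) * q ^ (c + 5 * m) =
      q ^ c * ((pNegOne (5 * m + c) : ℂ) * (q ^ 5) ^ m) := fun c m => by
    rw [add_comm c, pow_add, pow_mul]; ring
  simp only [hterm, tsum_mul_left]
  -- `ZMod 5` is `Fin 5` by definition, so the sum over residues can be written out.
  rw [show (∑ j : ZMod 5, q ^ j.val * ∑' m : ℕ, (pNegOne (5 * m + j.val) : ℂ) * (q ^ 5) ^ m) =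
    ∑ j : Fin 5, q ^ (j : ℕ) * ∑' m : ℕ, (pNegOne (5 * m + j) : ℂ) * (q ^ 5) ^ m from rfl,
    Fin.sum_univ_five]
  have h3 : ∀ m : ℕ, (pNegOne (5 * m + 3) : ℂ) * (q ^ 5) ^ m = 0 := fun m => by
    rw [pNegOne_five_mul_add_three]; simp
  have h4 : ∀ m : ℕ, (pNegOne (5 * m + 4) : ℂ) * (q ^ 5) ^ m = 0 := fun m => by
    rw [pNegOne_five_mul_add_four]; simp
  simp only [Fin.val_zero, Fin.val_one, Fin.val_two, show ((3 : Fin 5) : ℕ) = 3 from rfl,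
    show ((4 : Fin 5) : ℕ) = 4 from rfl, h3, h4, tsum_zero, add_zero,
    (hasSum_pNegOne_five_mul h0 hq5).tsum_eq, (hasSum_pNegOne_five_mul_add_one hq5).tsum_eq,
    (hasSum_pNegOne_five_mul_add_two h0 hq5).tsum_eq]
  ring

/-! ### Watson's modular equation -/

lemma geom_five_of_pow {w : ℂ} (hw : w ^ 5 = 1) (h1 : w ≠ 1) :
    1 + w + w ^ 2 + w ^ 3 + w ^ 4 = 0 := by
  have h : (w - 1) * (1 + w + w ^ 2 + w ^ 3 + w ^ 4) = 0 := by linear_combination hw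
  exact (mul_eq_zero.mp h).resolve_left (sub_ne_zero.mpr h1)

/-- For a ≠ 0, the quadratic a - ux + vx² is a(1-αx)(1-βx) with α+β = u/a and αβ = -(u/a)², so α and
β are u/a times the golden ratio and its conjugate. The product over fifth roots of unity is
a⁵(1-α⁵)(1-β⁵), and 11 is the Lucas number L₅. The proof pairs w with w⁴ and w² with w³, so that
only c = w + w⁴ with c² + c = 1 remains. -/
lemma prod_quadratic_five {w : ℂ} (hw : 1 + w + w ^ 2 + w ^ 3 + w ^ 4 = 0) {a u v : ℂ}
    (h : a * v = -u ^ 2) :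
    (a - u + v) * (a - w * u + w ^ 2 * v) * (a - w ^ 2 * u + (w ^ 2) ^ 2 * v) *
      (a - w ^ 3 * u + (w ^ 3) ^ 2 * v) * (a - w ^ 4 * u + (w ^ 4) ^ 2 * v) =
      a ^ 5 + v ^ 5 - 11 * u ^ 5 := by
  have h5 : w ^ 5 = 1 := by linear_combination (w - 1) * hw
  have e1 : (a - w * u + w ^ 2 * v) * (a - w ^ 4 * u + (w ^ 4) ^ 2 * v) =
      a ^ 2 + u ^ 2 + v ^ 2 - (a * u + u * v) * (w + w ^ 4) + a * v * (w ^ 2 + w ^ 3) := by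
    linear_combination (u ^ 2 + (w ^ 5 + 1) * v ^ 2 - w * u * v - w ^ 4 * u * v
      + w ^ 3 * a * v) * h5
  have e2 : (a - w ^ 2 * u + (w ^ 2) ^ 2 * v) * (a - w ^ 3 * u + (w ^ 3) ^ 2 * v) =
      a ^ 2 + u ^ 2 + v ^ 2 - (a * u + u * v) * (w ^ 2 + w ^ 3) + a * v * (w + w ^ 4) := by
    linear_combination (u ^ 2 + (w ^ 5 + 1) * v ^ 2 - w ^ 2 * u * v - w ^ 3 * u * v
      + w * a * v) * h5
  have hd : w ^ 2 + w ^ 3 = -1 - (w + w ^ 4) := by linear_combination hw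
  have hc : (w + w ^ 4) ^ 2 = 1 - (w + w ^ 4) := by
    linear_combination hw + (2 + w ^ 3) * h5
  have e3 : (a - u + v) * (a - w * u + w ^ 2 * v) * (a - w ^ 2 * u + (w ^ 2) ^ 2 * v) *
      (a - w ^ 3 * u + (w ^ 3) ^ 2 * v) * (a - w ^ 4 * u + (w ^ 4) ^ 2 * v) =
      (a - u + v) * ((a - w * u + w ^ 2 * v) * (a - w ^ 4 * u + (w ^ 4) ^ 2 * v)) *
      ((a - w ^ 2 * u + (w ^ 2) ^ 2 * v) * (a - w ^ 3 * u + (w ^ 3) ^ 2 * v)) := by ring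
  rw [e3, e1, e2, hd]
  set c := w + w ^ 4
  have e4 : (a ^ 2 + u ^ 2 + v ^ 2 - (a * u + u * v) * c + a * v * (-1 - c)) *
      (a ^ 2 + u ^ 2 + v ^ 2 - (a * u + u * v) * (-1 - c) + a * v * c) =
      (a ^ 2 + u ^ 2 + v ^ 2) ^ 2 + (a ^ 2 + u ^ 2 + v ^ 2) * (a * u + u * v - a * v)
        - (a * u + u * v) ^ 2 - (a * v) ^ 2 - 3 * (a * u + u * v) * (a * v) := by
    linear_combination (-(a * u + u * v + a * v) ^ 2) * hc
  rw [mul_assoc, e4]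
  linear_combination (5 * u ^ 3 - 5 * u * (a * v - u ^ 2)) * h

lemma prod_one_sub_five {w : ℂ} (hw : 1 + w + w ^ 2 + w ^ 3 + w ^ 4 = 0) (x : ℂ) :
    (1 - x) * (1 - w * x) * (1 - w ^ 2 * x) * (1 - w ^ 3 * x) * (1 - w ^ 4 * x) = 1 - x ^ 5 := by
  have h5 : w ^ 5 = 1 := by linear_combination (w - 1) * hw
  have e1 : (1 - w * x) * (1 - w ^ 4 * x) = 1 - (w + w ^ 4) * x + x ^ 2 := by
    linear_combination x ^ 2 * h5
  have e2 : (1 - w ^ 2 * x) * (1 - w ^ 3 * x) = 1 + (1 + (w + w ^ 4)) * x + x ^ 2 := by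
    linear_combination x ^ 2 * h5 - x * hw
  have hc : (w + w ^ 4) ^ 2 = 1 - (w + w ^ 4) := by
    linear_combination hw + (2 + w ^ 3) * h5
  calc _ = (1 - x) * ((1 - w * x) * (1 - w ^ 4 * x)) * ((1 - w ^ 2 * x) * (1 - w ^ 3 * x)) := by ring
    _ = _ := by
      rw [e1, e2]
      linear_combination (-(1 - x) * x ^ 2) * hc

/-- The product of Euler's product over the fifth roots of unity. -/
theorem prod_qPochInf_roots {w q : ℂ} (hw5 : w ^ 5 = 1) (hw1 : w ≠ 1) (hq : ‖q‖ < 1) :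
    qPochInf q q * qPochInf (w * q) (w * q) * qPochInf (w ^ 2 * q) (w ^ 2 * q) *
      qPochInf (w ^ 3 * q) (w ^ 3 * q) * qPochInf (w ^ 4 * q) (w ^ 4 * q) *
      qPochInf (q ^ 25) (q ^ 25) = qPochInf (q ^ 5) (q ^ 5) ^ 6 := by
  have hwn : ‖w‖ = 1 := Complex.norm_eq_one_of_pow_eq_one hw5 (by simp)
  have hn : ∀ j : ℕ, ‖w ^ j * q‖ < 1 := fun j => by simpa [hwn] using hq
  have hinj : Function.Injective fun n : ℕ => 5 * n + 4 := fun a b h => by simpa using h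
  have hrange : ∀ n : ℕ, n ∉ Set.range (fun n : ℕ => 5 * n + 4) → ¬ 5 ∣ n + 1 := by
    rintro n hn ⟨m, hm⟩
    exact hn ⟨m - 1, by simp only; lia⟩
  have hg : HasProd (fun n : ℕ => if 5 ∣ n + 1 then 1 - (q ^ 5) ^ (n + 1) else 1)
      (qPochInf (q ^ 25) (q ^ 25)) := by
    rw [← hinj.hasProd_iff fun n hn => if_neg (hrange n hn)]
    refine (hasProd_qPochInf_self (norm_pow_lt_one hq (by simp))).congr_fun fun n => ?_
    rw [Function.comp_apply, if_pos ⟨n + 1, by ring⟩]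
    ring
  have hh : HasProd (fun n : ℕ => if 5 ∣ n + 1 then 1 - q ^ (n + 1) else 1)
      (qPochInf (q ^ 5) (q ^ 5)) := by
    rw [← hinj.hasProd_iff fun n hn => if_neg (hrange n hn)]
    refine (hasProd_qPochInf_self (norm_pow_lt_one hq (by simp))).congr_fun fun n => ?_
    rw [Function.comp_apply, if_pos ⟨n + 1, by ring⟩]
    ring
  have hP : ∀ j : ℕ, HasProd (fun n : ℕ => 1 - (w ^ j * q) ^ (n + 1))
      (qPochInf (w ^ j * q) (w ^ j * q)) := fun j => hasProd_qPochInf_self (hn j)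
  have h1 := (((((hasProd_qPochInf_self hq).mul (hP 1)).mul (hP 2)).mul (hP 3)).mul (hP 4)).mul hg
  have h2 := (hasProd_qPochInf_self (norm_pow_lt_one hq (n := 5) (by simp))).mul
    ((((hh.mul hh).mul hh).mul hh).mul hh)
  rw [pow_one] at h1
  have h3 := h1.unique (h2.congr_fun fun n => ?_)
  · rw [h3]; ring
  -- With m = n+1: if 5 ∣ m, the five factors all equal 1 - q^m and `hg` supplies the missing 1 -
  -- q^(5m). Otherwise w^m is again a nontrivial fifth root of unity and the five factors multiply
  -- to 1 - q^(5m).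
  · by_cases hd : 5 ∣ n + 1
    · obtain ⟨m, hm⟩ := hd
      have hx : ∀ j : ℕ, (w ^ j * q) ^ (n + 1) = q ^ (n + 1) := fun j => by
        rw [mul_pow, ← pow_mul, hm, mul_left_comm, pow_mul, hw5, one_pow, one_mul]
      have hx1 := hx 1
      rw [pow_one] at hx1
      simp only [if_pos (Dvd.intro m hm.symm), hx, hx1]
      ring
    · have hz : 1 + w ^ (n + 1) + (w ^ (n + 1)) ^ 2 + (w ^ (n + 1)) ^ 3 + (w ^ (n + 1)) ^ 4 = 0 := by
        refine geom_five_of_pow (by rw [← pow_mul, mul_comm, pow_mul, hw5, one_pow]) fun h => ?_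
        have : Fact (Nat.Prime 5) := ⟨by norm_num⟩
        exact hd (orderOf_eq_prime hw5 hw1 ▸ orderOf_dvd_iff_pow_eq_one.mpr h)
      have := prod_one_sub_five hz (q ^ (n + 1))
      simp only [if_neg hd]
      linear_combination this

/-- The parts a, u, v of the dissection at q are multiplied by 1, w^j, w^(2j) when q is replaced by
w^j q, because the series in them depend only on q⁵. -/
theorem watson_modular_equation {q : ℂ} (hq : ‖q‖ < 1) :
    q * (qPochInf (q ^ 5) (q ^ 5) ^ 6 / qPochInf q q ^ 6) =
      5 ^ 2 * q ^ 5 * (qPochInf (q ^ 25) (q ^ 25) ^ 5 / qPochInf q q ^ 5) +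
      5 ^ 2 * q ^ 4 * (qPochInf (q ^ 25) (q ^ 25) ^ 4 / qPochInf q q ^ 4) +
      15 * q ^ 3 * (qPochInf (q ^ 25) (q ^ 25) ^ 3 / qPochInf q q ^ 3) +
      5 * q ^ 2 * (qPochInf (q ^ 25) (q ^ 25) ^ 2 / qPochInf q q ^ 2) +
      q * (qPochInf (q ^ 25) (q ^ 25) / qPochInf q q) := by
  rcases eq_or_ne q 0 with rfl | hq0
  · simp
  obtain ⟨w, hw5, hw1⟩ : ∃ w : ℂ, w ^ 5 = 1 ∧ w ≠ 1 := by
    have h := Complex.isPrimitiveRoot_exp 5 (by simp)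
    exact ⟨_, h.pow_eq_one, h.ne_one (by simp)⟩
  have hwn : ‖w‖ = 1 := Complex.norm_eq_one_of_pow_eq_one hw5 (by simp)
  have hw0 : w ≠ 0 := by rintro rfl; simp at hwn
  obtain ⟨hy0, hy1⟩ := rogersSum_ne_zero (pow_ne_zero 5 hq0) (norm_pow_lt_one hq (n := 5) (by simp))
  have hprod := prod_qPochInf_roots hw5 hw1 hq
  set G := qPochInf (q ^ 25) (q ^ 25) with hG
  set a := G * rogersSum (q ^ 5) 0 / rogersSum (q ^ 5) 1 with ha
  set v := q ^ 2 * (-(G * rogersSum (q ^ 5) 1) / rogersSum (q ^ 5) 0) with hv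
  have hav : a * v = -(q * G) ^ 2 := by
    rw [ha, hv]; field_simp
  have hE : ∀ j : ℕ, qPochInf (w ^ j * q) (w ^ j * q) =
      a - w ^ j * (q * G) + (w ^ j) ^ 2 * v := fun j => by
    have hx : (w ^ j * q) ^ 5 = q ^ 5 := by
      rw [mul_pow, ← pow_mul, mul_comm j, pow_mul, hw5, one_pow, one_mul]
    rw [qPochInf_dissection (mul_ne_zero (pow_ne_zero j hw0) hq0) (by simpa [hwn] using hq), hx,
      ← pow_mul, show 5 * 5 = 25 from rfl, ← hG, ha, hv]
    ring
  have hE0 := hE 0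
  have hE1 := hE 1
  simp only [pow_zero, one_mul, one_pow, pow_one] at hE0 hE1
  rw [hE1, hE 2, hE 3, hE 4, hE0, prod_quadratic_five (geom_five_of_pow hw5 hw1) hav] at hprod
  have hne := qPochInf_self_ne_zero hq
  set E := qPochInf q q
  have key : q * qPochInf (q ^ 5) (q ^ 5) ^ 6 = 25 * q ^ 5 * G ^ 5 * E + 25 * q ^ 4 * G ^ 4 * E ^ 2 +
      15 * q ^ 3 * G ^ 3 * E ^ 3 + 5 * q ^ 2 * G ^ 2 * E ^ 4 + q * G * E ^ 5 := by
    rw [← hprod, hE0]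
    -- With u = qG and s = a + v = E + u, the relation av = -u² gives a⁵ + v⁵ = s⁵ + 5u²s³ + 5u⁴s.
    -- Expanding in E and u, the terms in u⁵ add up to 11u⁵ and cancel.
    linear_combination (-(q * G) * (5 * (a + v) ^ 3 + 5 * (a + v) * ((q * G) ^ 2 - a * v))) * hav
  field_simp
  refine mul_left_cancel₀ hq0 ?_
  linear_combination key

/-! ### Dissections for higher powers of five -/

lemma two_index_succ (i : ℕ) : (5 ^ (2 * (i + 1) + 2) - 1) / 24 =
    25 * ((5 ^ (2 * i + 2) - 1) / 24) + 1 := by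
  have h : 24 ∣ 5 ^ (2 * i + 2) - 1 := by
    rw [show 2 * i + 2 = 2 * (i + 1) by ring, pow_mul]
    have h := Nat.sub_dvd_pow_sub_pow (5 ^ 2) 1 (i + 1)
    rwa [one_pow] at h
  have h1 : 1 ≤ 5 ^ (2 * i + 2) := Nat.one_le_pow _ _ (by simp)
  have h2 : 5 ^ (2 * (i + 1) + 2) = 25 * 5 ^ (2 * i + 2) := by ring
  lia

/-- This makes the subtraction of 5^(k-1) exact for k = 2i+1. -/
lemma pow_le_index (i : ℕ) : 5 ^ (2 * i) ≤ (5 ^ (2 * i + 2) - 1) / 24 := by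
  have h2 : 5 ^ (2 * i + 2) = 25 * 5 ^ (2 * i) := by ring
  have h1 : 1 ≤ 5 ^ (2 * i) := Nat.one_le_pow _ _ (by simp)
  lia

/-- Each lowering of i writes m as 25m' + 1 and costs one sign. The term 5^(2i) added to m avoids
subtraction and shifts the offset by one: the residue r corresponds to the offset (r-1)·5^(k-1),
where k = 2i+1. -/
lemma pNegOne_odd_power (i n r m : ℕ)
    (h : m + 5 ^ (2 * i) = 5 ^ (2 * i + 1) * n + (5 ^ (2 * i + 2) - 1) / 24 + r * 5 ^ (2 * i)) :
    pNegOne m = (-1) ^ i * pNegOne (5 * n + r) := by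
  induction i generalizing m with
  | zero => simp at h ⊢; rw [show m = 5 * n + r by lia]
  | succ i ih =>
    have h1 := pow_le_index i
    have e1 : 5 ^ (2 * (i + 1)) = 25 * 5 ^ (2 * i) := by ring
    have e2 : 5 ^ (2 * (i + 1) + 1) * n = 25 * (5 ^ (2 * i + 1) * n) := by ring
    have e3 : r * (25 * 5 ^ (2 * i)) = 25 * (r * 5 ^ (2 * i)) := by ring
    rw [two_index_succ, e2, e1, e3] at h
    have hm : m = 25 * (5 ^ (2 * i + 1) * n + (5 ^ (2 * i + 2) - 1) / 24 + r * 5 ^ (2 * i)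
      - 5 ^ (2 * i)) + 1 := by lia
    rw [hm, pNegOne_twentyFive_mul_add_one, ih _ (Nat.sub_add_cancel (by lia))]
    ring

lemma I_pow_two_mul (i : ℕ) : Complex.I ^ (2 * i) = (-1) ^ i := by
  rw [pow_mul, Complex.I_sq]

/-- The generating function along an odd power of five reduces to one along multiples of five. -/
lemma hasSum_odd_power {q a b : ℂ} {i r : ℕ} {f : ℕ → ℕ}
    (h : HasSum (fun n : ℕ => (pNegOne (5 * n + r) : ℂ) * q ^ n) a)
    (hf : ∀ n, f n + 5 ^ (2 * i) =
      5 ^ (2 * i + 1) * n + (5 ^ (2 * i + 2) - 1) / 24 + r * 5 ^ (2 * i))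
    (hb : b = (-1) ^ i * a) :
    HasSum (fun n : ℕ => (pNegOne (f n) : ℂ) * q ^ n) b := by
  rw [hb]
  refine (h.mul_left ((-1) ^ i)).congr_fun fun n => ?_
  rw [pNegOne_odd_power i n r (f n) (hf n)]
  push_cast
  ring

theorem hasSum_even_power {k : ℕ} (hk : Even k) (hk0 : k ≠ 0) {m : ℕ} (hm : m < 5) {q : ℂ}
    (hq : ‖q‖ < 1) :
    HasSum (fun n : ℕ =>
        (pNegOne (5 ^ k * n + (5 ^ k - 1) / 24 + 5 ^ (k - 1) * m) : ℂ) * q ^ n)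
      ((1 - (1 : DirichletCharacter ℂ 5) (m : ZMod 5)) * Complex.I ^ k * qPochInf q q) := by
  obtain ⟨i, rfl⟩ : ∃ i, k = 2 * i + 2 := by
    obtain ⟨j, rfl⟩ := hk
    exact ⟨j - 1, by lia⟩
  -- The progression for k = 2i+2 is the one for the odd power 2i+1 with r = 1, restricted to the
  -- indices 5n+m. Only m = 0 leaves nonzero coefficients, which is what 1 - χ(m) records.
  have hterm : ∀ n : ℕ, pNegOne (5 ^ (2 * i + 2) * n + (5 ^ (2 * i + 2) - 1) / 24 +
      5 ^ (2 * i + 2 - 1) * m) = (-1) ^ i * pNegOne (5 * (5 * n + m) + 1) := fun n => by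
    refine pNegOne_odd_power i (5 * n + m) 1 _ ?_
    rw [show 2 * i + 2 - 1 = 2 * i + 1 by lia]
    ring
  simp only [hterm]
  rcases Nat.eq_zero_or_pos m with rfl | hm0
  · have h0 : (1 : DirichletCharacter ℂ 5) ((0 : ℕ) : ZMod 5) = 0 := by
      have : Fact (1 < 5) := ⟨by simp⟩
      rw [Nat.cast_zero]
      exact MulChar.map_zero _
    rw [h0, sub_zero, one_mul, show 2 * i + 2 = 2 * (i + 1) by ring, I_pow_two_mul]
    refine ((hasSum_pNegOne hq).mul_left ((-1) ^ (i + 1))).congr_fun fun n => ?_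
    rw [show 5 * (5 * n + 0) + 1 = 25 * n + 1 by ring, pNegOne_twentyFive_mul_add_one]
    push_cast
    ring
  · have hu : IsUnit (m : ZMod 5) := by
      rw [ZMod.isUnit_iff_coprime]
      interval_cases m <;> norm_num
    rw [MulChar.one_apply hu, sub_self, zero_mul, zero_mul]
    refine hasSum_zero.congr_fun fun n => ?_
    rw [pNegOne_five_mul_add_one (by lia)]
    simp

/-- The first two clauses say that `p_{-1}` and `R` are what they are meant to be. In the clauses
involving `R`, the variable is `q = t ^ 5` with `t = q ^ (1/5)` any fifth root. All divisions and
subtractions of natural numbers are exact. -/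
theorem theorem6p1 :
    -- `(q; q)_∞ = ∑ p_{-1}(n) q ^ n`
    (∀ q : ℂ, ‖q‖ < 1 → HasSum (fun n : ℕ => (pNegOne n : ℂ) * q ^ n) (qPochInf q q)) ∧
    -- the continued fraction converges, to a nonzero value
    (∀ t : ℂ, 0 < ‖t‖ → ‖t‖ < 1 →
      Tendsto (rogersRamanujanFrac t).convs atTop (𝓝 (rogersRamanujan t)) ∧
      rogersRamanujan t ≠ 0) ∧
    -- odd `k`
    (∀ k : ℕ, Odd k →
      (∀ q : ℂ, ‖q‖ < 1 →
        HasSum (fun n : ℕ => (pNegOne (5 ^ k * n + (5 ^ (k + 1) - 1) / 24) : ℂ) * q ^ n)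
          (Complex.I ^ (k + 1) * qPochInf (q ^ 5) (q ^ 5))) ∧
      (∀ t : ℂ, 0 < ‖t‖ → ‖t‖ < 1 →
        HasSum (fun n : ℕ =>
            (pNegOne (5 ^ k * n + (5 ^ (k + 1) - 1) / 24 - 5 ^ (k - 1)) : ℂ) * (t ^ 5) ^ n)
          (Complex.I ^ (k - 1) * t * qPochInf ((t ^ 5) ^ 5) ((t ^ 5) ^ 5) /
            rogersRamanujan t)) ∧
      (∀ t : ℂ, 0 < ‖t‖ → ‖t‖ < 1 →
        HasSum (fun n : ℕ =>
            (pNegOne (5 ^ k * n + (5 ^ (k + 1) - 1) / 24 + 5 ^ (k - 1)) : ℂ) * (t ^ 5) ^ n)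
          (Complex.I ^ (k + 1) * t⁻¹ * qPochInf ((t ^ 5) ^ 5) ((t ^ 5) ^ 5) *
            rogersRamanujan t)) ∧
      (∀ q : ℂ, ‖q‖ < 1 →
        HasSum (fun n : ℕ =>
          (pNegOne (5 ^ k * n + (5 ^ (k + 1) - 1) / 24 + 2 * 5 ^ (k - 1)) : ℂ) * q ^ n) 0) ∧
      (∀ q : ℂ, ‖q‖ < 1 →
        HasSum (fun n : ℕ =>
          (pNegOne (5 ^ k * n + (5 ^ (k + 1) - 1) / 24 + 3 * 5 ^ (k - 1)) : ℂ) * q ^ n) 0)) ∧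
    -- even `k ≠ 0`, with `χ_{1,5}` the principal character modulo 5
    (∀ k : ℕ, Even k → k ≠ 0 → ∀ m : ℕ, m < 5 → ∀ q : ℂ, ‖q‖ < 1 →
      HasSum (fun n : ℕ =>
          (pNegOne (5 ^ k * n + (5 ^ k - 1) / 24 + 5 ^ (k - 1) * m) : ℂ) * q ^ n)
        ((1 - (1 : DirichletCharacter ℂ 5) (m : ZMod 5)) * Complex.I ^ k * qPochInf q q)) ∧
    -- Watson's modular equation
    (∀ q : ℂ, ‖q‖ < 1 →
      q * (qPochInf (q ^ 5) (q ^ 5) ^ 6 / qPochInf q q ^ 6) =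
        5 ^ 2 * q ^ 5 * (qPochInf (q ^ 25) (q ^ 25) ^ 5 / qPochInf q q ^ 5) +
        5 ^ 2 * q ^ 4 * (qPochInf (q ^ 25) (q ^ 25) ^ 4 / qPochInf q q ^ 4) +
        15 * q ^ 3 * (qPochInf (q ^ 25) (q ^ 25) ^ 3 / qPochInf q q ^ 3) +
        5 * q ^ 2 * (qPochInf (q ^ 25) (q ^ 25) ^ 2 / qPochInf q q ^ 2) +
        q * (qPochInf (q ^ 25) (q ^ 25) / qPochInf q q)) := by
  have ht5 : ∀ t : ℂ, ‖t‖ < 1 → ‖t ^ 5‖ < 1 := fun t ht => norm_pow_lt_one ht (by simp)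
  have hne : ∀ t : ℂ, 0 < ‖t‖ → t ≠ 0 := fun t ht => norm_pos_iff.mp ht
  have hR : ∀ t : ℂ, 0 < ‖t‖ → ‖t‖ < 1 →
      rogersRamanujan t = t * rogersSum (t ^ 5) 1 / rogersSum (t ^ 5) 0 := fun t h0 h1 =>
    rogersRamanujan_eq (ht5 t h1) (rogersSum_ne_zero (pow_ne_zero 5 (hne t h0)) (ht5 t h1)).1
  refine ⟨fun q hq => hasSum_pNegOne hq, fun t h0 h1 => ?_, fun k hk => ?_,
    fun k hk hk0 m hm q hq => hasSum_even_power hk hk0 hm hq,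
    fun q hq => watson_modular_equation hq⟩
  · obtain ⟨hy0, hy1⟩ := rogersSum_ne_zero (pow_ne_zero 5 (hne t h0)) (ht5 t h1)
    rw [hR t h0 h1]
    exact ⟨tendsto_convs (ht5 t h1) hy0, div_ne_zero (mul_ne_zero (hne t h0) hy1) hy0⟩
  obtain ⟨i, rfl⟩ := hk
  have hle := pow_le_index i
  rw [show 2 * i + 1 + 1 = 2 * (i + 1) by ring, I_pow_two_mul,
    show 2 * i + 1 - 1 = 2 * i by lia, I_pow_two_mul, show 2 * (i + 1) = 2 * i + 2 by ring]
  refine ⟨fun q hq => ?_, fun t h0 h1 => ?_, fun t h0 h1 => ?_, fun q hq => ?_, fun q hq => ?_⟩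
  · exact hasSum_odd_power (i := i) (r := 1) (hasSum_pNegOne_five_mul_add_one hq)
      (fun n => by ring) (by ring)
  · have ht := hne t h0
    obtain ⟨hy0, hy1⟩ := rogersSum_ne_zero (pow_ne_zero 5 ht) (ht5 t h1)
    refine hasSum_odd_power (i := i) (r := 0)
      (hasSum_pNegOne_five_mul (pow_ne_zero 5 ht) (ht5 t h1)) (fun n => by lia) ?_
    rw [hR t h0 h1]
    field_simp
  · have ht := hne t h0
    obtain ⟨hy0, hy1⟩ := rogersSum_ne_zero (pow_ne_zero 5 ht) (ht5 t h1)
    refine hasSum_odd_power (i := i) (r := 2)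
      (hasSum_pNegOne_five_mul_add_two (pow_ne_zero 5 ht) (ht5 t h1)) (fun n => by ring) ?_
    rw [hR t h0 h1]
    field_simp
    ring
  · refine hasSum_odd_power (a := 0) (i := i) (r := 3) ?_ (fun n => by ring) (mul_zero _).symm
    simpa only [pNegOne_five_mul_add_three, Int.cast_zero, zero_mul] using hasSum_zero
  · refine hasSum_odd_power (a := 0) (i := i) (r := 4) ?_ (fun n => by ring) (mul_zero _).symm
    simpa only [pNegOne_five_mul_add_four, Int.cast_zero, zero_mul] using hasSum_zero
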